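/- Let $p,r\ge 0$, $q=p+r$, $A^0\in\mathbb R^{p\times p}$, $B^0\in\mathbb R^{p\times r}$, $\Theta^0=[A^0,B^0]\in\mathbb R^{p\times q}$, and consider the linear system $x(0)=0$, $x(t+1)=A^0x(t)+B^0u(t)+w(t+1)$ for $t\ge 0$, where the entries of the vectors $w(1),w(2),\dots\in\mathbb R^p$ are i.i.d. standard normal, driven by $u(t)=-Lx(t)$ with $L\in\mathbb R^{r\times p}$. Let $k\ge 1$ and assume that $\Theta^0$ is $k$-sparse, i.e. each row of $\Theta^0$ has at most $k$ nonzero entries. Put $\widetilde L=[I,-L^{\mathsf T}]^{\mathsf T}\in\mathbb R^{q\times p}$. For $C_{\min}>0$ and $\alpha>0$ assume that $L$ is $(\rho,C_{\min},\alpha)$-identifiable with respect to $\Theta^0$: $\|A^0-B^0L\|_2\le\rho<1$, and with $\Lambda$ the solution of the Lyapunov equation $\Lambda-\Theta^0\widetilde L\Lambda\widetilde L^{\mathsf T}(\Theta^0)^{\mathsf T}=I$ and $H=\widetilde L\Lambda\widetilde L^{\mathsf T}$, every $S\subseteq[q]$ with $|S|\le k$ satisfies $\lambda_{\min}(H_{SS})\ge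 C_{\min}$ and $\|H_{S^cS}H_{SS}^{-1}\|_\infty\le 1-\alpha$ (here $\|\cdot\|_2$ and $\|\cdot\|_\infty$ are the operator norms induced by the Euclidean norm and the sup norm; the conditions are void for $S=\emptyset$ except that $1-\alpha\ge 0$). Let $\ell=\max(1,\max_{j\in[r]}\|L_j\|_2)$, where $L_j$ is the $j$-th row of $L$, and let $\Theta_{\min}=\min\{|\Theta^0_{ij}|:\Theta^0_{ij}\ne0\}$ ($+\infty$ if $\Theta^0=0$). Let $0<\delta<1$, let $0<\epsilon<\min\big(\Theta_{\min},\frac{\ell}{2},\frac{3}{1-\rho}\big)$, and let $n$ be an integer with $$n\ \ge\ \frac{4\cdot10^3\,k^2\ell^2}{\alpha^2(1-\rho)C_{\min}^2}\Big(\frac1{\epsilon^2}+\frac{k}{(1-\rho)^2}\Big)\log\Big(\frac{4kq}{\delta}\Big),\qquad \lambda=6\,\ell\,\sqrt{\frac{\log(4q/\delta)}{n\,\alpha^2(1-\rho)}}.$$ Consider the $\ell_1$-regularized least squares problems, one for each row $i\in[p]$, $$\widehat\Theta_i\in\arg\min_{\theta\in\mathbb R^q}\ \frac1{2n}\sum_{t=0}^{n-1}\big(x_i(t+1)-\theta^{\mathsf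 T}\widetilde Lx(t)\big)^2+\lambda\|\theta\|_1 .$$ Then a solution $\widehat\Theta$ always exists, and with probability larger than $1-\delta$ every solution $\widehat\Theta$ satisfies $\max_{i\in[p]}\|\widehat\Theta_i-\Theta^0_i\|_2\le\epsilon$. (More precisely, the outer probability that some solution violates this bound is less than $\delta$.) -/

import Mathlib

open MeasureTheory ProbabilityTheory
open scoped Matrix

noncomputable section

namespace LQ

/-- The Euclidean norm `‖v‖₂` of a finite real vector. -/
def l2Norm {ι : Type*} [Fintype ι] (v : ι → ℝ) : ℝ := ‖WithLp.toLp 2 v‖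

/-- The `ℓ¹` norm `‖v‖₁` of a finite real vector. -/
def l1Norm {ι : Type*} [Fintype ι] (v : ι → ℝ) : ℝ := ∑ j, |v j|

open scoped Matrix.Norms.L2Operator in
/-- The operator norm `‖M‖₂` induced by the Euclidean norms. -/
def opNormTwo {m n : Type*} [Fintype m] [Fintype n] [DecidableEq n] (M : Matrix m n ℝ) : ℝ := ‖M‖

open scoped Matrix.Norms.Operator in
/-- The operator norm `‖M‖_∞` induced by the sup norms (the maximal absolute row sum). -/
def opNormInf {m n : Type*} [Fintype m] [Fintype n] (M : Matrix m n ℝ) : ℝ := ‖M‖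

/-- The interaction matrix `Θ = [A, B]`, of size `p × (p + r)`. -/
def interaction {p r : ℕ} (A : Matrix (Fin p) (Fin p) ℝ) (B : Matrix (Fin p) (Fin r) ℝ) :
    Matrix (Fin p) (Fin p ⊕ Fin r) ℝ :=
  Matrix.fromCols A B

/-- The matrix `L̃ = [I, -Lᵀ]ᵀ`, of size `(p + r) × p`, so that `L̃ x = [x; u]` when `u = -L x`. -/
def extendedGain {p r : ℕ} (L : Matrix (Fin r) (Fin p) ℝ) :
    Matrix (Fin p ⊕ Fin r) (Fin p) ℝ :=
  Matrix.fromRows 1 (-L)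

/-- `Λ` solves the Lyapunov equation `Λ - Θ L̃ Λ L̃ᵀ Θᵀ = I`. -/
def IsLyapunovSolution {p r : ℕ} (Θ : Matrix (Fin p) (Fin p ⊕ Fin r) ℝ)
    (L : Matrix (Fin r) (Fin p) ℝ) (Λ : Matrix (Fin p) (Fin p) ℝ) : Prop :=
  Λ - Θ * extendedGain L * Λ * (extendedGain L)ᵀ * Θᵀ = 1

/-- The matrix `Θ` is `k`-sparse: every row has at most `k` nonzero entries. -/
def IsSparse {p r : ℕ} (k : ℕ) (Θ : Matrix (Fin p) (Fin p ⊕ Fin r) ℝ) : Prop :=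
  ∀ u, {j | Θ u j ≠ 0}.ncard ≤ k

/-- The submatrix `M_{JS}` formed by the rows in `J` and the columns in `S`. -/
def block {ι : Type*} (M : Matrix ι ι ℝ) (J S : Finset ι) : Matrix J S ℝ :=
  M.submatrix Subtype.val Subtype.val

/-- `L` is a `(ρ, C_min, α)` identifiable regulator with respect to `Θ = [A, B]`, at sparsity
level `k`. Because the closed loop has norm at most `ρ < 1`, the Lyapunov equation has exactly one
solution `Λ`. The condition on the spectrum says `λ_min(H_SS) ≥ C_min` (void for `S = ∅`). -/
def IsIdentifiable {p r : ℕ} (k : ℕ) (ρ Cmin α : ℝ) (A : Matrix (Fin p) (Fin p) ℝ)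
    (B : Matrix (Fin p) (Fin r) ℝ) (L : Matrix (Fin r) (Fin p) ℝ) : Prop :=
  opNormTwo (A - B * L) ≤ ρ ∧ ρ < 1 ∧
  ∃ Λ : Matrix (Fin p) (Fin p) ℝ, IsLyapunovSolution (interaction A B) L Λ ∧
    ∀ H : Matrix (Fin p ⊕ Fin r) (Fin p ⊕ Fin r) ℝ,
      H = extendedGain L * Λ * (extendedGain L)ᵀ →
      ∀ S : Finset (Fin p ⊕ Fin r), S.card ≤ k →
        (∀ c ∈ spectrum ℝ (block H S S), Cmin ≤ c) ∧
        opNormInf (block H Sᶜ S * (block H S S)⁻¹) ≤ 1 - α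

/-- `Θ_min`, the smallest absolute value of a nonzero entry of `Θ` (`⊤` if `Θ = 0`). -/
def minEntry {p r : ℕ} (Θ : Matrix (Fin p) (Fin p ⊕ Fin r) ℝ) : EReal :=
  ⨅ (u) (j) (_ : Θ u j ≠ 0), ((|Θ u j| : ℝ) : EReal)

/-- `ℓ = max(1, max_j ‖L_j‖₂)`, with `L_j` the rows of `L`. -/
def gainBound {p r : ℕ} (L : Matrix (Fin r) (Fin p) ℝ) : ℝ :=
  max 1 (⨆ j, l2Norm (L j))

/-- The normalised loss of a row `θ` as predictor of the coordinate `i` of the next state, along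
the first `n` transitions of the trajectory `x`. -/
def loss {p r : ℕ} (L : Matrix (Fin r) (Fin p) ℝ) (n : ℕ) (x : ℕ → Fin p → ℝ) (i : Fin p)
    (θ : Fin p ⊕ Fin r → ℝ) : ℝ :=
  1 / (2 * (n : ℝ)) * ∑ t ∈ Finset.range n, (x (t + 1) i - θ ⬝ᵥ (extendedGain L *ᵥ x t)) ^ 2

/-- `Θ` is an `ℓ¹`-regularised least squares solution: each of its rows minimises the loss plus
`lam` times the `ℓ¹` norm. -/
def IsLasso {p r : ℕ} (L : Matrix (Fin r) (Fin p) ℝ) (n : ℕ) (lam : ℝ) (x : ℕ → Fin p → ℝ)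
    (Θ : Matrix (Fin p) (Fin p ⊕ Fin r) ℝ) : Prop :=
  ∀ (i : Fin p) (θ : Fin p ⊕ Fin r → ℝ),
    loss L n x i (Θ i) + lam * l1Norm (Θ i) ≤ loss L n x i θ + lam * l1Norm θ

/-- The distance `d(Θ, Θ') = max_i ‖Θ_i - Θ'_i‖₂` over the rows. -/
def rowDist {p r : ℕ} (Θ Θ' : Matrix (Fin p) (Fin p ⊕ Fin r) ℝ) : ℝ :=
  ⨆ i, l2Norm (Θ i - Θ' i)

end LQ

end

/-! In closed loop the state obeys `x (t + 1) = M x t + W t` with `M = A - B L` and `W t = w (t +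
1)`, and row `i` is a linear regression with covariates `z t = L̃ x t` and noise `W t i`. Up to a
constant, its loss at `θ = θ₀ + Δ` is `Δ ⬝ᵥ Q *ᵥ Δ / 2 - G ⬝ᵥ Δ`, where `Q` is the sample second
moment of the covariates and `G` their sample correlation with the noise. The proof has a
deterministic and a probabilistic half.

Deterministic half (`lasso_row_error`). Let `S` be the support of `θ₀`. Any minimiser vanishes
outside `S` once `G` is small against `α * lam` and each coordinate outside `S` has a sample
regression on `S` with coefficients of `ℓ¹` norm at most `1 - 7 / 8 * α` (`lasso_support`). The
argument applies to every minimiser, so no uniqueness is needed. Positive definiteness of `Q` on `S`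
then bounds the error by a multiple of `√k * lam / C` (`lasso_error`). Closeness of `Q` to its
stationary limit `H` is needed only on a few test vectors: an `H`-orthonormal basis `f` of the
vectors supported on `S`, and, paired with `f`, the residuals `Pi.single j 1 - b j` of the
population regressions, which are `H`-orthogonal to `f`. Working in the whitened basis gives the
second factor of each covariance variance one, which saves a factor in the sample size.

Probabilistic half. Each `a ⬝ᵥ x t` is linear in the noise, so the entries of `G` and the tested
values of `Q` are quadratic forms in independent standard normals. The explicit Hanson-Wright bound
`gaussian_quadratic_abs_tail` needs an operator bound, `l2Norm a / (1 - ρ)` for a readout by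
stability, and a Frobenius bound, which the Lyapunov series supplies. Starting at rest instead of in
stationarity costs only a bounded bias. The sample size makes every tail at most `2 * exp (-2 K)` or
`2 * exp (-2 J)`, with `K`, `J` the two logarithms of the theorem, and a union bound over rows and
test vectors finishes. -/

namespace LQ

/-! ### Exponential moments of a squared standard normal -/

/-- The series of `-log (1 - y)` after its linear term is `y ^ 2 * ∑ y ^ m / (m + 2)`; it is
dominated termwise by half a geometric series of ratio `β`. -/
lemma neg_log_one_sub_sub_le {y β : ℝ} (hy : |y| ≤ β) (hβ : β < 1) :
    -Real.log (1 - y) - y ≤ y ^ 2 / (2 * (1 - β)) := by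
  have h0 : 0 ≤ β := (abs_nonneg y).trans hy
  have h1 := Real.hasSum_pow_div_log_of_abs_lt_one (hy.trans_lt hβ)
  have h2 := (hasSum_nat_add_iff' 1).2 h1
  have h3 := (hasSum_geometric_of_lt_one h0 hβ).mul_left (y ^ 2 / 2)
  have h4 := hasSum_le (fun m => ?_) h2 h3
  · simp only [Finset.sum_range_one, zero_add, pow_one, Nat.cast_zero, div_one] at h4
    refine h4.trans (le_of_eq ?_)
    rw [div_mul_eq_div_div, div_eq_mul_inv _ (1 - β)]
  · have h5 : y ^ m ≤ β ^ m := (le_abs_self _).trans (by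
      rw [abs_pow]; exact pow_le_pow_left₀ (abs_nonneg y) hy m)
    have h6 : (0 : ℝ) ≤ m := Nat.cast_nonneg m
    rw [show y ^ (m + 1 + 1) = y ^ 2 * y ^ m by ring, div_mul_eq_mul_div]
    push_cast
    gcongr
    linarith

lemma integrable_exp_mul_sq_gaussianReal {c : ℝ} (hc : c < 1 / 2) :
    Integrable (fun x => Real.exp (c * x ^ 2)) (gaussianReal 0 1) := by
  rw [gaussianReal_of_var_ne_zero 0 one_ne_zero, gaussianPDF_def,
    integrable_withDensity_iff_integrable_smul₀' (by fun_prop) (by simp)]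
  have : (fun x : ℝ => (ENNReal.ofReal (gaussianPDFReal 0 1 x)).toReal • Real.exp (c * x ^ 2)) =
      fun x => (√(2 * Real.pi))⁻¹ * Real.exp (-(1 / 2 - c) * x ^ 2) := by
    ext x
    rw [ENNReal.toReal_ofReal (gaussianPDFReal_nonneg _ _ _), gaussianPDFReal_def, smul_eq_mul]
    simp only [NNReal.coe_one, mul_one, sub_zero, mul_assoc]
    rw [← Real.exp_add]
    ring_nf
  rw [this]
  exact (integrable_exp_neg_mul_sq (by linarith)).const_mul _

lemma integral_exp_mul_sq_gaussianReal {c : ℝ} (hc : c < 1 / 2) :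
    ∫ x, Real.exp (c * x ^ 2) ∂(gaussianReal 0 1) = (√(1 - 2 * c))⁻¹ := by
  rw [integral_gaussianReal_eq_integral_smul one_ne_zero]
  have : (fun x : ℝ => gaussianPDFReal 0 1 x • Real.exp (c * x ^ 2)) =
      fun x => (√(2 * Real.pi))⁻¹ * Real.exp (-(1 / 2 - c) * x ^ 2) := by
    ext x
    rw [gaussianPDFReal_def, smul_eq_mul]
    simp only [NNReal.coe_one, mul_one, sub_zero, mul_assoc]
    rw [← Real.exp_add]
    ring_nf
  rw [this, integral_const_mul, integral_gaussian, ← Real.sqrt_inv, ← Real.sqrt_inv,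
    ← Real.sqrt_mul (by positivity)]
  congr 1
  have : (1 : ℝ) / 2 - c ≠ 0 := by linarith
  have : (1 : ℝ) - 2 * c ≠ 0 := by linarith
  have := Real.pi_ne_zero
  field_simp

lemma inv_sqrt_one_sub_le {y β : ℝ} (hy : |y| ≤ β) (hβ : β < 1) :
    (√(1 - y))⁻¹ ≤ Real.exp (y / 2 + y ^ 2 / (4 * (1 - β))) := by
  have h1 : 0 < 1 - y := by linarith [le_abs_self y]
  have h2 : (√(1 - y))⁻¹ = Real.exp (-Real.log (1 - y) / 2) := by
    rw [neg_div, Real.exp_neg, ← Real.log_sqrt h1.le, Real.exp_log (Real.sqrt_pos.2 h1)]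
  rw [h2, Real.exp_le_exp]
  have h3 := neg_log_one_sub_sub_le hy hβ
  have h4 : y ^ 2 / (4 * (1 - β)) = y ^ 2 / (2 * (1 - β)) / 2 := by
    rw [div_div]; ring
  linarith

/-! ### Hanson-Wright inequality with explicit constants -/

section HansonWright

variable {ι : Type*}

/-- The symmetric part of a square matrix. -/
noncomputable def symPart (N : Matrix ι ι ℝ) : Matrix ι ι ℝ :=
  Matrix.of fun a b => (N a b + N b a) / 2

lemma symPart_isHermitian (N : Matrix ι ι ℝ) : (symPart N).IsHermitian := by
  ext a b
  simp [symPart, add_comm]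

variable [Fintype ι]

lemma dotProduct_symPart_mulVec (N : Matrix ι ι ℝ) (v : ι → ℝ) :
    v ⬝ᵥ symPart N *ᵥ v = v ⬝ᵥ N *ᵥ v := by
  have h : symPart N = (1 / 2 : ℝ) • (N + Nᵀ) := by
    ext a b
    simp [symPart]
    ring
  have h' : v ⬝ᵥ Nᵀ *ᵥ v = v ⬝ᵥ N *ᵥ v := by
    rw [Matrix.mulVec_transpose, dotProduct_comm, ← Matrix.dotProduct_mulVec]
  rw [h, Matrix.smul_mulVec, Matrix.add_mulVec, dotProduct_smul, dotProduct_add, h', smul_eq_mul]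
  ring

lemma trace_symPart (N : Matrix ι ι ℝ) : (symPart N).trace = N.trace := by
  simp [Matrix.trace, symPart]

variable [DecidableEq ι]

/-- The squared eigenvalue is the squared length of `Q` applied to the unit eigenvector; summing
over the eigenbasis is Parseval for each row of `Q`. -/
lemma sum_eigenvalues_sq {Q : Matrix ι ι ℝ} (hQ : Q.IsHermitian) :
    ∑ a, hQ.eigenvalues a ^ 2 = ∑ a, ∑ b, Q a b ^ 2 := by
  have h1 : ∀ a, hQ.eigenvalues a ^ 2 =
      ∑ i, (inner ℝ (WithLp.toLp 2 (Q i)) (hQ.eigenvectorBasis a)) ^ 2 := by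
    intro a
    have h2 : ∀ i, inner ℝ (WithLp.toLp 2 (Q i)) (hQ.eigenvectorBasis a) =
        hQ.eigenvalues a * hQ.eigenvectorBasis a i := by
      intro i
      have := congrFun (hQ.mulVec_eigenvectorBasis a) i
      simp only [Pi.smul_apply, smul_eq_mul] at this
      rw [← this, EuclideanSpace.inner_eq_star_dotProduct, Matrix.mulVec, dotProduct_comm]
      simp
    simp_rw [h2, mul_pow]
    rw [← Finset.mul_sum, ← EuclideanSpace.real_norm_sq_eq, hQ.eigenvectorBasis.norm_eq_one]
    simp
  simp_rw [h1]
  rw [Finset.sum_comm]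
  refine Finset.sum_congr rfl fun i _ => ?_
  rw [hQ.eigenvectorBasis.sum_sq_inner_left, EuclideanSpace.real_norm_sq_eq]

lemma dotProduct_mulVec_eigenvectorBasis {Q : Matrix ι ι ℝ} (hQ : Q.IsHermitian) (y : ι → ℝ) :
    WithLp.ofLp (∑ a, y a • hQ.eigenvectorBasis a) ⬝ᵥ
      Q *ᵥ WithLp.ofLp (∑ a, y a • hQ.eigenvectorBasis a) =
    ∑ a, hQ.eigenvalues a * y a ^ 2 := by
  have h1 : Q *ᵥ WithLp.ofLp (∑ a, y a • hQ.eigenvectorBasis a) =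
      WithLp.ofLp (∑ a, (hQ.eigenvalues a * y a) • hQ.eigenvectorBasis a) := by
    simp only [WithLp.ofLp_sum, WithLp.ofLp_smul, Matrix.mulVec_sum, Matrix.mulVec_smul,
      hQ.mulVec_eigenvectorBasis, smul_smul]
    exact Finset.sum_congr rfl fun a _ => by rw [mul_comm]
  have h2 := EuclideanSpace.inner_eq_star_dotProduct
    (∑ a, (hQ.eigenvalues a * y a) • hQ.eigenvectorBasis a) (∑ a, y a • hQ.eigenvectorBasis a)
  rw [star_trivial] at h2
  rw [h1, ← h2, hQ.eigenvectorBasis.orthonormal.inner_sum]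
  exact Finset.sum_congr rfl fun a _ => by simp; ring

lemma abs_eigenvalues_symPart_le {N : Matrix ι ι ℝ} {b : ℝ}
    (hb : ∀ v : ι → ℝ, |v ⬝ᵥ N *ᵥ v| ≤ b * ∑ a, v a ^ 2) (a : ι) :
    |(symPart_isHermitian N).eigenvalues a| ≤ b := by
  have h1 := dotProduct_mulVec_eigenvectorBasis (symPart_isHermitian N) (Pi.single a 1)
  have h2 : ∑ c, (Pi.single a 1 : ι → ℝ) c • (symPart_isHermitian N).eigenvectorBasis c =
      (symPart_isHermitian N).eigenvectorBasis a := by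
    simp [Pi.single_apply]
  rw [h2, dotProduct_symPart_mulVec] at h1
  have h3 := hb ((symPart_isHermitian N).eigenvectorBasis a)
  rw [h1, ← EuclideanSpace.real_norm_sq_eq, OrthonormalBasis.norm_eq_one] at h3
  simpa [Pi.single_apply] using h3

/-- Bernstein bound for the moment generating function of a quadratic form in independent standard
normal variables. -/
lemma integrable_and_integral_exp_quadratic_le {N : Matrix ι ι ℝ} {b V s : ℝ}
    (hb : ∀ v : ι → ℝ, |v ⬝ᵥ N *ᵥ v| ≤ b * ∑ a, v a ^ 2)
    (hV : ∑ a, ∑ c, symPart N a c ^ 2 ≤ V) (hs : 0 ≤ s) (hsb : 2 * s * b < 1) :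
    Integrable (fun v : ι → ℝ => Real.exp (s * (v ⬝ᵥ N *ᵥ v)))
      (Measure.pi fun _ => gaussianReal 0 1) ∧
    ∫ v : ι → ℝ, Real.exp (s * (v ⬝ᵥ N *ᵥ v)) ∂(Measure.pi fun _ => gaussianReal 0 1) ≤
      Real.exp (s * N.trace + s ^ 2 * V / (1 - 2 * s * b)) := by
  set hQ := symPart_isHermitian N
  set P : Measure (ι → ℝ) := Measure.pi fun _ => gaussianReal 0 1 with hP
  set T : (ι → ℝ) → EuclideanSpace ℝ ι := fun y => ∑ a, y a • hQ.eigenvectorBasis a with hT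
  have hTm : Measurable T := by fun_prop
  -- Rotation invariance: coordinates in the eigenbasis of the symmetric part are again independent
  -- standard normals, so the form becomes a weighted sum of independent squares and the expectation
  -- factorises.
  have hmap : P.map (WithLp.toLp 2) = P.map T :=
    map_pi_eq_stdGaussian.trans (stdGaussian_eq_map_pi_orthonormalBasis hQ.eigenvectorBasis)
  set F : EuclideanSpace ℝ ι → ℝ := fun v => Real.exp (s * (v.ofLp ⬝ᵥ N *ᵥ v.ofLp)) with hF
  have hFm : Continuous F := by
    have : Continuous fun v : EuclideanSpace ℝ ι => v.ofLp ⬝ᵥ N *ᵥ v.ofLp := by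
      simp only [dotProduct, Matrix.mulVec]
      fun_prop
    fun_prop
  have hFT : F ∘ T = fun y => ∏ a, Real.exp (s * hQ.eigenvalues a * y a ^ 2) := by
    ext y
    simp only [hF, hT, Function.comp]
    rw [← dotProduct_symPart_mulVec, dotProduct_mulVec_eigenvectorBasis, Finset.mul_sum,
      Real.exp_sum]
    simp only [mul_assoc]
  have hy : ∀ a, |2 * (s * hQ.eigenvalues a)| ≤ 2 * s * b := by
    intro a
    rw [abs_mul, abs_mul, abs_two, abs_of_nonneg hs, ← mul_assoc]
    gcongr
    exact abs_eigenvalues_symPart_le hb a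
  have hlt : ∀ a, s * hQ.eigenvalues a < 1 / 2 := by
    intro a
    linarith [(le_abs_self _).trans (hy a)]
  have hint : Integrable (F ∘ T) P := by
    rw [hFT]
    exact Integrable.fintype_prod fun a => integrable_exp_mul_sq_gaussianReal (hlt a)
  have hcomp : (fun v : ι → ℝ => Real.exp (s * (v ⬝ᵥ N *ᵥ v))) = F ∘ WithLp.toLp 2 := rfl
  have hm2 : Measurable (WithLp.toLp 2 : (ι → ℝ) → EuclideanSpace ℝ ι) := by fun_prop
  constructor
  · rw [hcomp, ← integrable_map_measure hFm.aestronglyMeasurable hm2.aemeasurable, hmap,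
      integrable_map_measure hFm.aestronglyMeasurable hTm.aemeasurable]
    exact hint
  · have h1 : ∫ v, Real.exp (s * (v ⬝ᵥ N *ᵥ v)) ∂P = ∫ y, (F ∘ T) y ∂P := by
      have h2 := integral_map (μ := P) hm2.aemeasurable hFm.aestronglyMeasurable
      rw [hmap, integral_map hTm.aemeasurable hFm.aestronglyMeasurable] at h2
      exact h2.symm
    rw [h1, hFT, hP, integral_fintype_prod_eq_prod
      (f := fun a y => Real.exp (s * hQ.eigenvalues a * y ^ 2))]
    calc ∏ a, ∫ y, Real.exp (s * hQ.eigenvalues a * y ^ 2) ∂(gaussianReal 0 1)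
        ≤ ∏ a, Real.exp (s * hQ.eigenvalues a +
            s ^ 2 * hQ.eigenvalues a ^ 2 / (1 - 2 * s * b)) := by
          refine Finset.prod_le_prod (fun a _ => integral_nonneg fun _ => (Real.exp_pos _).le)
            fun a _ => ?_
          rw [integral_exp_mul_sq_gaussianReal (hlt a)]
          refine (inv_sqrt_one_sub_le (hy a) hsb).trans (le_of_eq ?_)
          congr 1
          have : 1 - 2 * s * b ≠ 0 := by linarith
          field_simp
          ring
      _ = Real.exp (s * N.trace + s ^ 2 * (∑ a, ∑ c, symPart N a c ^ 2) / (1 - 2 * s * b)) := by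
          rw [← Real.exp_sum, Finset.sum_add_distrib, ← Finset.mul_sum, ← Finset.sum_div,
            ← Finset.mul_sum, sum_eigenvalues_sq, ← trace_symPart N, hQ.trace_eq_sum_eigenvalues]
          simp
      _ ≤ _ := by
          have : 0 < 1 - 2 * s * b := by linarith
          gcongr

lemma pi_gaussian_quadratic_tail {N : Matrix ι ι ℝ} {b V t : ℝ}
    (hb : ∀ v : ι → ℝ, |v ⬝ᵥ N *ᵥ v| ≤ b * ∑ a, v a ^ 2)
    (hV : ∑ a, ∑ c, symPart N a c ^ 2 ≤ V) (hb0 : 0 ≤ b) (hV0 : 0 < V) (ht : 0 ≤ t) :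
    (Measure.pi fun _ : ι => gaussianReal 0 1).real {v | N.trace + t ≤ v ⬝ᵥ N *ᵥ v} ≤
      Real.exp (-(t ^ 2 / (4 * V + 4 * b * t))) := by
  have hD : 0 < V + b * t := by positivity
  -- Chernoff parameter chosen so that `1 - 2 * s * b = V / (V + b * t)`; the exponent collapses to
  -- `-s * t + s ^ 2 * (V + b * t)`, of which this `s` is the minimiser.
  set s := t / (2 * (V + b * t)) with hs
  have hs0 : 0 ≤ s := by positivity
  have h1 : 1 - 2 * s * b = V / (V + b * t) := by
    rw [hs]; field_simp; ring
  have hsb : 2 * s * b < 1 := by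
    have : 0 < V / (V + b * t) := by positivity
    linarith
  obtain ⟨hi, hle⟩ := integrable_and_integral_exp_quadratic_le hb hV hs0 hsb
  refine (measure_ge_le_exp_mul_mgf (N.trace + t) hs0 hi).trans ?_
  rw [mgf]
  calc _ ≤ Real.exp (-s * (N.trace + t)) *
        Real.exp (s * N.trace + s ^ 2 * V / (1 - 2 * s * b)) := by gcongr
    _ = _ := by
      rw [← Real.exp_add, h1, hs]
      congr 1
      field_simp
      ring

/-- Hanson-Wright inequality for quadratic forms in independent standard normal variables, with
explicit constants. -/
theorem gaussian_quadratic_abs_tail {Ω : Type*} [MeasurableSpace Ω] {μ : Measure Ω}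
    [IsProbabilityMeasure μ] {ξ : ι → Ω → ℝ} (hξ : iIndepFun ξ μ)
    (hlaw : ∀ a, HasLaw (ξ a) (gaussianReal 0 1) μ) {N : Matrix ι ι ℝ} {b V t : ℝ}
    (hb : ∀ v : ι → ℝ, |v ⬝ᵥ N *ᵥ v| ≤ b * ∑ a, v a ^ 2)
    (hV : ∑ a, ∑ c, symPart N a c ^ 2 ≤ V) (hb0 : 0 ≤ b) (hV0 : 0 < V) (ht : 0 ≤ t) :
    μ {ω | t ≤ |(fun a => ξ a ω) ⬝ᵥ N *ᵥ (fun a => ξ a ω) - N.trace|} ≤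
      ENNReal.ofReal (2 * Real.exp (-(t ^ 2 / (4 * V + 4 * b * t)))) := by
  have hae : AEMeasurable (fun ω a => ξ a ω) μ :=
    aemeasurable_pi_lambda _ fun a => (hlaw a).aemeasurable
  have hmap : μ.map (fun ω a => ξ a ω) = Measure.pi fun _ => gaussianReal 0 1 := by
    rw [(iIndepFun_iff_map_fun_eq_pi_map fun a => (hlaw a).aemeasurable).1 hξ]
    simp only [(hlaw _).map_eq]
  have hneg : symPart (-N) = -symPart N := by
    ext a c
    simp [symPart]
    ring
  have h1 := pi_gaussian_quadratic_tail hb hV hb0 hV0 ht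
  have h2 := pi_gaussian_quadratic_tail (N := -N)
    (fun v => by simpa [Matrix.neg_mulVec] using hb v) (by simpa [hneg] using hV) hb0 hV0 ht
  set P : Measure (ι → ℝ) := Measure.pi fun _ => gaussianReal 0 1
  have hcont : Continuous fun v : ι → ℝ => v ⬝ᵥ N *ᵥ v := by
    simp only [dotProduct, Matrix.mulVec]
    fun_prop
  have hmeas : MeasurableSet {v : ι → ℝ | t ≤ |v ⬝ᵥ N *ᵥ v - N.trace|} :=
    measurableSet_le measurable_const (by fun_prop)
  have h3 : μ {ω | t ≤ |(fun a => ξ a ω) ⬝ᵥ N *ᵥ (fun a => ξ a ω) - N.trace|} =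
      P {v | t ≤ |v ⬝ᵥ N *ᵥ v - N.trace|} := by
    rw [← hmap, Measure.map_apply_of_aemeasurable hae hmeas]
    rfl
  have h4 : {v : ι → ℝ | t ≤ |v ⬝ᵥ N *ᵥ v - N.trace|} ⊆
      {v | N.trace + t ≤ v ⬝ᵥ N *ᵥ v} ∪ {v | (-N).trace + t ≤ v ⬝ᵥ (-N) *ᵥ v} := by
    intro v hv
    simp only [Set.mem_ofPred_eq, le_abs, Set.mem_union, Matrix.trace_neg, Matrix.neg_mulVec,
      dotProduct_neg] at hv ⊢
    rcases hv with hv | hv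
    · left; linarith
    · right; linarith
  rw [h3, ← ofReal_measureReal (measure_ne_top _ _)]
  refine ENNReal.ofReal_le_ofReal ?_
  refine (measureReal_mono h4).trans ((measureReal_union_le _ _).trans ?_)
  linarith

end HansonWright

/-! ### Euclidean, operator and Frobenius norms -/

section Norms

variable {ι κ : Type*} [Fintype ι] [Fintype κ]

lemma l2Norm_nonneg (v : ι → ℝ) : 0 ≤ l2Norm v := norm_nonneg _

lemma l2Norm_sq (v : ι → ℝ) : l2Norm v ^ 2 = ∑ i, v i ^ 2 := by
  rw [l2Norm, EuclideanSpace.real_norm_sq_eq]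

lemma dotProduct_self_eq (v : ι → ℝ) : v ⬝ᵥ v = l2Norm v ^ 2 := by
  rw [l2Norm_sq, dotProduct]
  exact Finset.sum_congr rfl fun i _ => (sq _).symm

lemma l2Norm_zero : l2Norm (0 : ι → ℝ) = 0 := by simp [l2Norm]

lemma l2Norm_add_le (v w : ι → ℝ) : l2Norm (v + w) ≤ l2Norm v + l2Norm w := norm_add_le _ _

lemma l2Norm_smul (c : ℝ) (v : ι → ℝ) : l2Norm (c • v) = |c| * l2Norm v := by
  simp [l2Norm, norm_smul]

lemma l2Norm_neg (v : ι → ℝ) : l2Norm (-v) = l2Norm v := by simp [l2Norm]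

lemma l2Norm_sum_le {σ : Type*} (S : Finset σ) (v : σ → ι → ℝ) :
    l2Norm (∑ s ∈ S, v s) ≤ ∑ s ∈ S, l2Norm (v s) := by
  simp only [l2Norm, WithLp.toLp_sum]
  exact norm_sum_le _ _

lemma abs_dotProduct_le (v w : ι → ℝ) : |v ⬝ᵥ w| ≤ l2Norm v * l2Norm w := by
  have h := abs_real_inner_le_norm (WithLp.toLp 2 w) (WithLp.toLp 2 v)
  rw [EuclideanSpace.inner_eq_star_dotProduct, star_trivial, mul_comm] at h
  exact h

lemma l2Norm_mulVec_le [DecidableEq κ] (M : Matrix ι κ ℝ) (v : κ → ℝ) :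
    l2Norm (M *ᵥ v) ≤ opNormTwo M * l2Norm v :=
  Matrix.l2_opNorm_mulVec M (WithLp.toLp 2 v)

lemma opNormTwo_nonneg [DecidableEq κ] (M : Matrix ι κ ℝ) : 0 ≤ opNormTwo M := by
  open scoped Matrix.Norms.L2Operator in exact norm_nonneg M

lemma opNormTwo_transpose [DecidableEq ι] [DecidableEq κ] (M : Matrix ι κ ℝ) :
    opNormTwo Mᵀ = opNormTwo M := by
  have := Matrix.l2_opNorm_conjTranspose M
  rwa [Matrix.conjTranspose_eq_transpose_of_trivial] at this

lemma l2Norm_vecMul_le [DecidableEq ι] [DecidableEq κ] (M : Matrix ι κ ℝ) (v : ι → ℝ) :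
    l2Norm (v ᵥ* M) ≤ opNormTwo M * l2Norm v := by
  rw [← Matrix.mulVec_transpose, ← opNormTwo_transpose]
  exact l2Norm_mulVec_le _ _

/-- A bound on the action of a matrix on vectors is a bound on the action of its transpose. -/
lemma sum_transpose_mulVec_sq_le {ψ : Matrix ι κ ℝ} {c : ℝ} (hc : 0 ≤ c)
    (h : ∀ v, l2Norm (ψ *ᵥ v) ≤ c * l2Norm v) (u : ι → ℝ) :
    l2Norm (ψᵀ *ᵥ u) ≤ c * l2Norm u := by
  have h1 : l2Norm (ψᵀ *ᵥ u) ^ 2 ≤ l2Norm u * (c * l2Norm (ψᵀ *ᵥ u)) := by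
    rw [← dotProduct_self_eq, Matrix.dotProduct_mulVec, Matrix.vecMul_transpose, dotProduct_comm]
    exact (le_abs_self _).trans ((abs_dotProduct_le _ _).trans
      (mul_le_mul_of_nonneg_left (h _) (l2Norm_nonneg _)))
  rcases (l2Norm_nonneg (ψᵀ *ᵥ u)).eq_or_lt with h0 | h0
  · rw [← h0]
    exact mul_nonneg hc (l2Norm_nonneg _)
  · nlinarith

/-- Each column of the product is `ψᵀ` applied to a column of `φ`, so the operator bound for `ψᵀ`
applies column by column. -/
lemma sum_sq_transpose_mul_le {σ : Type*} [Fintype σ] {ψ : Matrix ι κ ℝ} {φ : Matrix ι σ ℝ}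
    {c : ℝ} (hc : 0 ≤ c) (h : ∀ v, l2Norm (ψ *ᵥ v) ≤ c * l2Norm v) :
    ∑ a, ∑ b, (ψᵀ * φ) a b ^ 2 ≤ c ^ 2 * ∑ t, ∑ b, φ t b ^ 2 := by
  rw [Finset.sum_comm, Finset.sum_comm (f := fun t b => φ t b ^ 2), Finset.mul_sum]
  refine Finset.sum_le_sum fun b _ => ?_
  have h1 := sum_transpose_mulVec_sq_le hc h (fun t => φ t b)
  have h2 := pow_le_pow_left₀ (l2Norm_nonneg _) h1 2
  rw [mul_pow, l2Norm_sq, l2Norm_sq] at h2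
  exact h2

lemma sum_symPart_sq_le (N : Matrix ι ι ℝ) :
    ∑ a, ∑ b, symPart N a b ^ 2 ≤ ∑ a, ∑ b, N a b ^ 2 := by
  have h1 : ∑ a, ∑ b, symPart N a b ^ 2 ≤ ∑ a, ∑ b, (N a b ^ 2 / 2 + N b a ^ 2 / 2) := by
    refine Finset.sum_le_sum fun a _ => Finset.sum_le_sum fun b _ => ?_
    simp only [symPart, Matrix.of_apply]
    nlinarith [sq_nonneg (N a b - N b a)]
  refine h1.trans (le_of_eq ?_)
  simp only [Finset.sum_add_distrib]
  rw [Finset.sum_comm (f := fun a b => N b a ^ 2 / 2)]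
  simp only [← Finset.sum_div]
  ring

/-- The cross terms vanish, so symmetrising halves the squared Frobenius norm. The noise term gains
this factor two. -/
lemma sum_symPart_sq_eq (N : Matrix ι ι ℝ) (hN : ∀ a b, N a b * N b a = 0) :
    ∑ a, ∑ b, symPart N a b ^ 2 = (∑ a, ∑ b, N a b ^ 2) / 2 := by
  have h1 : ∑ a, ∑ b, symPart N a b ^ 2 = ∑ a, ∑ b, (N a b ^ 2 / 4 + N b a ^ 2 / 4) := by
    refine Finset.sum_congr rfl fun a _ => Finset.sum_congr rfl fun b _ => ?_
    simp only [symPart, Matrix.of_apply]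
    linear_combination (1 / 2) * hN a b
  rw [h1]
  simp only [Finset.sum_add_distrib]
  rw [Finset.sum_comm (f := fun a b => N b a ^ 2 / 4)]
  simp only [← Finset.sum_div]
  ring

end Norms

/-! ### The Lyapunov solution as a series -/

section Lyapunov

variable {p : ℕ} {M Λ : Matrix (Fin p) (Fin p) ℝ} {ρ : ℝ}

lemma l2Norm_vecMul_pow_le (hM : opNormTwo M ≤ ρ) (a : Fin p → ℝ) (m : ℕ) :
    l2Norm (a ᵥ* M ^ m) ≤ ρ ^ m * l2Norm a := by
  have hρ : 0 ≤ ρ := (opNormTwo_nonneg M).trans hM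
  induction m with
  | zero => simp
  | succ m ih =>
    rw [pow_succ, ← Matrix.vecMul_vecMul]
    refine (l2Norm_vecMul_le _ _).trans ?_
    calc opNormTwo M * l2Norm (a ᵥ* M ^ m) ≤ ρ * (ρ ^ m * l2Norm a) := by
          gcongr
          exact l2Norm_nonneg _
      _ = _ := by ring

lemma abs_dotProduct_vecMul_pow_le (hM : opNormTwo M ≤ ρ) (a b : Fin p → ℝ) (m : ℕ) :
    |(a ᵥ* M ^ m) ⬝ᵥ (b ᵥ* M ^ m)| ≤ (ρ ^ 2) ^ m * (l2Norm a * l2Norm b) := by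
  have hρ : 0 ≤ ρ := (opNormTwo_nonneg M).trans hM
  refine (abs_dotProduct_le _ _).trans ?_
  calc _ ≤ (ρ ^ m * l2Norm a) * (ρ ^ m * l2Norm b) :=
        mul_le_mul (l2Norm_vecMul_pow_le hM a m) (l2Norm_vecMul_pow_le hM b m)
          (l2Norm_nonneg _) (mul_nonneg (pow_nonneg hρ m) (l2Norm_nonneg _))
    _ = _ := by ring

/-- Iterating the equation keeps an exact remainder, which serves twice: it tends to zero in the
series for `Λ`, and it is the bias of the chain started at rest. -/
lemma lyapunov_expansion (hΛ : Λ = 1 + M * Λ * Mᵀ) (a b : Fin p → ℝ) (t : ℕ) :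
    a ⬝ᵥ Λ *ᵥ b = ∑ m ∈ Finset.range t, (a ᵥ* M ^ m) ⬝ᵥ (b ᵥ* M ^ m) +
      (a ᵥ* M ^ t) ⬝ᵥ Λ *ᵥ (b ᵥ* M ^ t) := by
  induction t with
  | zero => simp
  | succ t ih =>
    rw [ih, Finset.sum_range_succ, add_assoc]
    congr 1
    have h (c d : Fin p → ℝ) : c ⬝ᵥ Λ *ᵥ d = c ⬝ᵥ d + (c ᵥ* M) ⬝ᵥ Λ *ᵥ (d ᵥ* M) := by
      conv_lhs => rw [hΛ]
      rw [Matrix.add_mulVec, dotProduct_add, Matrix.one_mulVec, ← Matrix.mulVec_mulVec,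
        ← Matrix.mulVec_mulVec, Matrix.mulVec_transpose, Matrix.dotProduct_mulVec c M]
    rw [h, Matrix.vecMul_vecMul, Matrix.vecMul_vecMul, pow_succ]

variable (hM : opNormTwo M ≤ ρ) (hρ : ρ < 1) (hΛ : Λ = 1 + M * Λ * Mᵀ)
include hM hρ hΛ

lemma hasSum_lyapunov (a b : Fin p → ℝ) :
    HasSum (fun m => (a ᵥ* M ^ m) ⬝ᵥ (b ᵥ* M ^ m)) (a ⬝ᵥ Λ *ᵥ b) := by
  have hρ0 : 0 ≤ ρ := (opNormTwo_nonneg M).trans hM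
  have hρ2 : ρ ^ 2 < 1 := by nlinarith
  have hs : Summable fun m => (a ᵥ* M ^ m) ⬝ᵥ (b ᵥ* M ^ m) :=
    Summable.of_norm_bounded ((summable_geometric_of_lt_one (sq_nonneg ρ) hρ2).mul_right _)
      fun m => abs_dotProduct_vecMul_pow_le hM a b m
  rw [hs.hasSum_iff_tendsto_nat]
  have hrem : Filter.Tendsto (fun t => (a ᵥ* M ^ t) ⬝ᵥ Λ *ᵥ (b ᵥ* M ^ t)) Filter.atTop
      (nhds 0) := by
    have h0 : Filter.Tendsto (fun t => (ρ ^ 2) ^ t * (l2Norm a * (opNormTwo Λ * l2Norm b)))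
        Filter.atTop (nhds 0) := by
      simpa using (tendsto_pow_atTop_nhds_zero_of_lt_one (sq_nonneg ρ) hρ2).mul_const
        (l2Norm a * (opNormTwo Λ * l2Norm b))
    refine squeeze_zero_norm (fun t => ?_) h0
    refine (abs_dotProduct_le _ _).trans ?_
    calc _ ≤ (ρ ^ t * l2Norm a) * (opNormTwo Λ * (ρ ^ t * l2Norm b)) := by
          refine mul_le_mul (l2Norm_vecMul_pow_le hM a t) ((l2Norm_mulVec_le _ _).trans ?_)
            (l2Norm_nonneg _) (mul_nonneg (pow_nonneg hρ0 t) (l2Norm_nonneg _))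
          exact mul_le_mul_of_nonneg_left (l2Norm_vecMul_pow_le hM b t) (opNormTwo_nonneg _)
      _ = _ := by ring
  have h1 := (tendsto_const_nhds (x := a ⬝ᵥ Λ *ᵥ b)).sub hrem
  rw [sub_zero] at h1
  refine h1.congr fun t => ?_
  rw [lyapunov_expansion hΛ a b t]
  ring

/-- Symmetry of `Λ` is not assumed; it follows because the terms of the series are symmetric in `a`
and `b`. -/
lemma lyapunov_symm (a b : Fin p → ℝ) : a ⬝ᵥ Λ *ᵥ b = b ⬝ᵥ Λ *ᵥ a := by
  refine (hasSum_lyapunov hM hρ hΛ a b).unique ?_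
  simpa only [dotProduct_comm] using hasSum_lyapunov hM hρ hΛ b a

lemma abs_lyapunov_le (a b : Fin p → ℝ) :
    |a ⬝ᵥ Λ *ᵥ b| ≤ l2Norm a * l2Norm b / (1 - ρ ^ 2) := by
  have hρ0 : 0 ≤ ρ := (opNormTwo_nonneg M).trans hM
  have hρ2 : ρ ^ 2 < 1 := by nlinarith
  have h1 := hasSum_lyapunov hM hρ hΛ a b
  have h2 := (hasSum_geometric_of_lt_one (sq_nonneg ρ) hρ2).mul_right (l2Norm a * l2Norm b)
  have h3 := tsum_of_norm_bounded
    (f := fun m => (a ᵥ* M ^ m) ⬝ᵥ (b ᵥ* M ^ m)) h2 fun m => abs_dotProduct_vecMul_pow_le hM a b m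
  rw [h1.tsum_eq] at h3
  refine h3.trans (le_of_eq ?_)
  rw [mul_comm, div_eq_mul_inv]

lemma sum_range_le_lyapunov (a : Fin p → ℝ) (t : ℕ) :
    ∑ m ∈ Finset.range t, l2Norm (a ᵥ* M ^ m) ^ 2 ≤ a ⬝ᵥ Λ *ᵥ a := by
  have h := sum_le_hasSum (Finset.range t) (fun m _ => ?_) (hasSum_lyapunov hM hρ hΛ a a)
  · simpa only [dotProduct_self_eq] using h
  · rw [dotProduct_self_eq]
    positivity

/-- The covariance at time `t` misses the stationary one by the Lyapunov remainder, of order `ρ ^ (2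
* t)`, so the total defect is bounded uniformly in `n`. -/
lemma abs_lyapunov_sub_sum_range_le (a b : Fin p → ℝ) (n : ℕ) :
    |∑ t ∈ Finset.range n, ∑ m ∈ Finset.range t, (a ᵥ* M ^ m) ⬝ᵥ (b ᵥ* M ^ m) -
      n * (a ⬝ᵥ Λ *ᵥ b)| ≤ l2Norm a * l2Norm b / (1 - ρ ^ 2) ^ 2 := by
  have hρ0 : 0 ≤ ρ := (opNormTwo_nonneg M).trans hM
  have hρ2 : ρ ^ 2 < 1 := by nlinarith
  have h1 : ∑ t ∈ Finset.range n, ∑ m ∈ Finset.range t, (a ᵥ* M ^ m) ⬝ᵥ (b ᵥ* M ^ m) -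
      n * (a ⬝ᵥ Λ *ᵥ b) =
      ∑ t ∈ Finset.range n, -((a ᵥ* M ^ t) ⬝ᵥ Λ *ᵥ (b ᵥ* M ^ t)) := by
    have h2 : (n : ℝ) * (a ⬝ᵥ Λ *ᵥ b) = ∑ t ∈ Finset.range n, a ⬝ᵥ Λ *ᵥ b := by simp
    rw [h2, ← Finset.sum_sub_distrib]
    refine Finset.sum_congr rfl fun t _ => ?_
    rw [lyapunov_expansion hΛ a b t]
    ring
  rw [h1]
  refine (Finset.abs_sum_le_sum_abs _ _).trans ?_
  have hd : 0 < 1 - ρ ^ 2 := by linarith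
  have hab : 0 ≤ l2Norm a * l2Norm b := mul_nonneg (l2Norm_nonneg _) (l2Norm_nonneg _)
  calc _ ≤ ∑ t ∈ Finset.range n, (ρ ^ 2) ^ t * (l2Norm a * l2Norm b / (1 - ρ ^ 2)) := by
        refine Finset.sum_le_sum fun t _ => ?_
        rw [abs_neg]
        refine (abs_lyapunov_le hM hρ hΛ _ _).trans ?_
        rw [← mul_div_assoc]
        refine div_le_div_of_nonneg_right ?_ hd.le
        calc _ ≤ (ρ ^ t * l2Norm a) * (ρ ^ t * l2Norm b) :=
              mul_le_mul (l2Norm_vecMul_pow_le hM a t) (l2Norm_vecMul_pow_le hM b t)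
                (l2Norm_nonneg _) (mul_nonneg (pow_nonneg hρ0 t) (l2Norm_nonneg _))
          _ = _ := by ring
    _ ≤ (1 - ρ ^ 2)⁻¹ * (l2Norm a * l2Norm b / (1 - ρ ^ 2)) := by
        rw [← Finset.sum_mul]
        refine mul_le_mul_of_nonneg_right ?_ (by positivity)
        exact sum_le_hasSum _ (fun t _ => by positivity)
          (hasSum_geometric_of_lt_one (sq_nonneg ρ) hρ2)
    _ = _ := by field_simp

end Lyapunov

/-! ### The state as a linear function of the noise -/

section Trajectory

variable {p : ℕ} {M : Matrix (Fin p) (Fin p) ℝ} {ρ : ℝ}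

lemma dotProduct_trajectory {W x : ℕ → Fin p → ℝ} (h0 : x 0 = 0)
    (hx : ∀ t, x (t + 1) = M *ᵥ x t + W t) (t : ℕ) (a : Fin p → ℝ) :
    a ⬝ᵥ x t = ∑ s ∈ Finset.range t, (a ᵥ* M ^ (t - 1 - s)) ⬝ᵥ W s := by
  induction t generalizing a with
  | zero => simp [h0]
  | succ t ih =>
    rw [hx, dotProduct_add, Matrix.dotProduct_mulVec, ih, Finset.sum_range_succ]
    congr 1
    · refine Finset.sum_congr rfl fun s hs => ?_
      rw [Matrix.vecMul_vecMul, ← pow_succ']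
      have := Finset.mem_range.1 hs
      congr 3
      omega
    · simp

/-- Stability in energy form: convexity gives `(ρ a + b) ^ 2 ≤ ρ a ^ 2 + b ^ 2 / (1 - ρ)`, and
summing over time absorbs the first term on the left. Thus the map from noise to state has norm at
most `1 / (1 - ρ)`. -/
lemma sum_l2Norm_sq_trajectory_le (hM : opNormTwo M ≤ ρ) (hρ : ρ < 1) {W x : ℕ → Fin p → ℝ}
    (h0 : x 0 = 0) (hx : ∀ t, x (t + 1) = M *ᵥ x t + W t) (n : ℕ) :
    ∑ t ∈ Finset.range n, l2Norm (x t) ^ 2 ≤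
      (∑ s ∈ Finset.range n, l2Norm (W s) ^ 2) / (1 - ρ) ^ 2 := by
  have hρ0 : 0 ≤ ρ := (opNormTwo_nonneg M).trans hM
  have hd : 0 < 1 - ρ := by linarith
  have hstep : ∀ t, l2Norm (x (t + 1)) ^ 2 ≤
      ρ * l2Norm (x t) ^ 2 + l2Norm (W t) ^ 2 / (1 - ρ) := by
    intro t
    have h1 : l2Norm (x (t + 1)) ≤ ρ * l2Norm (x t) + l2Norm (W t) := by
      rw [hx]
      refine (l2Norm_add_le _ _).trans (add_le_add_left ((l2Norm_mulVec_le _ _).trans ?_) _)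
      exact mul_le_mul_of_nonneg_right hM (l2Norm_nonneg _)
    refine (pow_le_pow_left₀ (l2Norm_nonneg _) h1 2).trans ?_
    have h2 : ρ * l2Norm (x t) ^ 2 + l2Norm (W t) ^ 2 / (1 - ρ) -
        (ρ * l2Norm (x t) + l2Norm (W t)) ^ 2 =
        ρ * ((1 - ρ) * l2Norm (x t) - l2Norm (W t)) ^ 2 / (1 - ρ) := by
      field_simp
      ring
    have h3 : 0 ≤ ρ * ((1 - ρ) * l2Norm (x t) - l2Norm (W t)) ^ 2 / (1 - ρ) := by positivity
    linarith
  have hsum : ∑ t ∈ Finset.range (n + 1), l2Norm (x t) ^ 2 ≤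
      ρ * ∑ t ∈ Finset.range n, l2Norm (x t) ^ 2 +
        (∑ s ∈ Finset.range n, l2Norm (W s) ^ 2) / (1 - ρ) := by
    rw [Finset.sum_range_succ', h0, l2Norm_zero, Finset.mul_sum, Finset.sum_div,
      ← Finset.sum_add_distrib]
    simpa using Finset.sum_le_sum fun t _ => hstep t
  rw [Finset.sum_range_succ] at hsum
  rw [le_div_iff₀ (by positivity)]
  have h4 : (1 - ρ) * ∑ t ∈ Finset.range n, l2Norm (x t) ^ 2 ≤
      (∑ s ∈ Finset.range n, l2Norm (W s) ^ 2) / (1 - ρ) := by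
    nlinarith [sq_nonneg (l2Norm (x n))]
  rw [le_div_iff₀ hd] at h4
  linarith

/-- The matrix of the linear map from the noise `W 0, …, W (n - 1)` to the linear readouts
`a ⬝ᵥ x 0, …, a ⬝ᵥ x (n - 1)` of the trajectory `x (t + 1) = M x t + W t`, `x 0 = 0`. -/
noncomputable def readout (M : Matrix (Fin p) (Fin p) ℝ) (n : ℕ) (a : Fin p → ℝ) :
    Matrix (Fin n) (Fin n × Fin p) ℝ :=
  Matrix.of fun t s => if s.1 < t then (a ᵥ* M ^ ((t : ℕ) - 1 - s.1)) s.2 else 0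

lemma readout_mulVec {W x : ℕ → Fin p → ℝ} (h0 : x 0 = 0)
    (hx : ∀ t, x (t + 1) = M *ᵥ x t + W t) {n : ℕ} (a : Fin p → ℝ) (t : Fin n) :
    (readout M n a *ᵥ fun s => W s.1 s.2) t = a ⬝ᵥ x t := by
  rw [dotProduct_trajectory h0 hx, Matrix.mulVec, dotProduct, Fintype.sum_prod_type]
  have h1 : ∀ s : Fin n, ∑ i, readout M n a t (s, i) * W s i =
      if (s : ℕ) < t then (a ᵥ* M ^ ((t : ℕ) - 1 - s)) ⬝ᵥ W s else 0 := by
    intro s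
    simp only [readout, Matrix.of_apply, Fin.lt_def, dotProduct]
    split_ifs <;> simp
  simp only [h1]
  rw [Fin.sum_univ_eq_sum_range
    (fun s => if s < (t : ℕ) then (a ᵥ* M ^ ((t : ℕ) - 1 - s)) ⬝ᵥ W s else 0) n,
    ← Finset.sum_filter]
  congr 1
  ext s
  simp only [Finset.mem_filter, Finset.mem_range]
  have := t.2
  omega

lemma sum_readout_mul_readout (n : ℕ) (a b : Fin p → ℝ) :
    ∑ t, ∑ s, readout M n a t s * readout M n b t s =
      ∑ t ∈ Finset.range n, ∑ m ∈ Finset.range t, (a ᵥ* M ^ m) ⬝ᵥ (b ᵥ* M ^ m) := by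
  rw [← Fin.sum_univ_eq_sum_range
    (fun t => ∑ m ∈ Finset.range t, (a ᵥ* M ^ m) ⬝ᵥ (b ᵥ* M ^ m))]
  refine Finset.sum_congr rfl fun t _ => ?_
  rw [Fintype.sum_prod_type]
  have h1 : ∀ s : Fin n, ∑ i, readout M n a t (s, i) * readout M n b t (s, i) =
      if (s : ℕ) < t then
        (a ᵥ* M ^ ((t : ℕ) - 1 - s)) ⬝ᵥ (b ᵥ* M ^ ((t : ℕ) - 1 - s)) else 0 := by
    intro s
    simp only [readout, Matrix.of_apply, Fin.lt_def, dotProduct]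
    split_ifs <;> simp
  simp only [h1]
  rw [Fin.sum_univ_eq_sum_range (fun s => if s < (t : ℕ) then
      (a ᵥ* M ^ ((t : ℕ) - 1 - s)) ⬝ᵥ (b ᵥ* M ^ ((t : ℕ) - 1 - s)) else 0) n,
    ← Finset.sum_filter, ← Finset.sum_range_reflect]
  refine Finset.sum_congr ?_ fun _ _ => rfl
  ext s
  simp only [Finset.mem_filter, Finset.mem_range]
  have := t.2
  omega

lemma l2Norm_readout_mulVec_le (hM : opNormTwo M ≤ ρ) (hρ : ρ < 1) (n : ℕ) (a : Fin p → ℝ)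
    (v : Fin n × Fin p → ℝ) :
    l2Norm (readout M n a *ᵥ v) ≤ l2Norm a / (1 - ρ) * l2Norm v := by
  have hd : 0 < 1 - ρ := by linarith
  -- The vector `v` is fed to the system as its noise, extended by zero, so that the energy bound
  -- for trajectories becomes an operator bound.
  set W : ℕ → Fin p → ℝ := fun s i => if h : s < n then v (⟨s, h⟩, i) else 0 with hW
  set x : ℕ → Fin p → ℝ := fun t => Nat.rec 0 (fun s y => M *ᵥ y + W s) t with hx
  have hv : v = fun s => W s.1 s.2 := by
    ext s
    simp [hW]
  have h1 := sum_l2Norm_sq_trajectory_le (W := W) (x := x) hM hρ rfl (fun _ => rfl) n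
  have h2 : ∑ s ∈ Finset.range n, l2Norm (W s) ^ 2 = l2Norm v ^ 2 := by
    rw [l2Norm_sq, hv, Fintype.sum_prod_type,
      ← Fin.sum_univ_eq_sum_range (fun s => l2Norm (W s) ^ 2)]
    simp only [l2Norm_sq]
  have h3 : l2Norm (readout M n a *ᵥ v) ^ 2 ≤
      l2Norm a ^ 2 * ∑ t ∈ Finset.range n, l2Norm (x t) ^ 2 := by
    rw [l2Norm_sq, Finset.mul_sum,
      ← Fin.sum_univ_eq_sum_range (fun t => l2Norm a ^ 2 * l2Norm (x t) ^ 2)]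
    refine Finset.sum_le_sum fun t _ => ?_
    rw [hv, readout_mulVec (x := x) rfl (fun _ => rfl), ← mul_pow, ← sq_abs]
    exact pow_le_pow_left₀ (abs_nonneg _) (abs_dotProduct_le _ _) 2
  rw [h2] at h1
  refine le_of_sq_le_sq ?_ (mul_nonneg (div_nonneg (l2Norm_nonneg _) hd.le) (l2Norm_nonneg _))
  calc _ ≤ l2Norm a ^ 2 * (l2Norm v ^ 2 / (1 - ρ) ^ 2) :=
        h3.trans (mul_le_mul_of_nonneg_left h1 (sq_nonneg _))
    _ = _ := by field_simp

end Trajectory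

/-! ### Concentration for linear readouts of the state -/

section Tails

variable {p : ℕ} {M Λ : Matrix (Fin p) (Fin p) ℝ} {ρ : ℝ}

/-- The matrix of the quadratic form `∑ t, W t i * (a ⬝ᵥ x t)` of the noise `W`. -/
noncomputable def noiseReadout (M : Matrix (Fin p) (Fin p) ℝ) (n : ℕ) (i : Fin p)
    (a : Fin p → ℝ) : Matrix (Fin n × Fin p) (Fin n × Fin p) ℝ :=
  Matrix.of fun t s => if t.2 = i then readout M n a t.1 s else 0

lemma dotProduct_noiseReadout_mulVec (n : ℕ) (i : Fin p) (a : Fin p → ℝ)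
    (v : Fin n × Fin p → ℝ) :
    v ⬝ᵥ noiseReadout M n i a *ᵥ v = (fun t => v (t, i)) ⬝ᵥ readout M n a *ᵥ v := by
  rw [dotProduct, Fintype.sum_prod_type, dotProduct]
  refine Finset.sum_congr rfl fun t _ => ?_
  rw [Finset.sum_eq_single i]
  · simp [noiseReadout, Matrix.mulVec, dotProduct]
  · intro j _ hj
    simp [noiseReadout, Matrix.mulVec, dotProduct, hj]
  · simp

/-- Causality: the state at a given time depends only on strictly earlier noise, so the matrix is
strictly triangular in time. -/
lemma noiseReadout_mul_swap (n : ℕ) (i : Fin p) (a : Fin p → ℝ) (s t : Fin n × Fin p) :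
    noiseReadout M n i a s t * noiseReadout M n i a t s = 0 := by
  simp only [noiseReadout, readout, Matrix.of_apply]
  by_cases h1 : t.1 < s.1
  · simp [h1.not_gt]
  · simp [h1]

lemma trace_noiseReadout (n : ℕ) (i : Fin p) (a : Fin p → ℝ) :
    (noiseReadout M n i a).trace = 0 := by
  simp [Matrix.trace, noiseReadout, readout]

lemma sum_noiseReadout_sq (n : ℕ) (i : Fin p) (a : Fin p → ℝ) :
    ∑ t, ∑ s, noiseReadout M n i a t s ^ 2 = ∑ t, ∑ s, readout M n a t s ^ 2 := by
  rw [Fintype.sum_prod_type]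
  refine Finset.sum_congr rfl fun t _ => ?_
  rw [Finset.sum_eq_single i]
  · simp [noiseReadout]
  · intro j _ hj
    simp [noiseReadout, hj]
  · simp

lemma abs_dotProduct_noiseReadout_le (hM : opNormTwo M ≤ ρ) (hρ : ρ < 1) (n : ℕ) (i : Fin p)
    (a : Fin p → ℝ) (v : Fin n × Fin p → ℝ) :
    |v ⬝ᵥ noiseReadout M n i a *ᵥ v| ≤ l2Norm a / (1 - ρ) * ∑ s, v s ^ 2 := by
  have hd : 0 < 1 - ρ := by linarith
  rw [dotProduct_noiseReadout_mulVec, ← l2Norm_sq]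
  have h1 : l2Norm (fun t => v (t, i)) ≤ l2Norm v := by
    refine le_of_sq_le_sq ?_ (l2Norm_nonneg _)
    rw [l2Norm_sq, l2Norm_sq, Fintype.sum_prod_type]
    exact Finset.sum_le_sum fun t _ =>
      Finset.single_le_sum (f := fun j => v (t, j) ^ 2) (fun _ _ => sq_nonneg _)
        (Finset.mem_univ i)
  refine (abs_dotProduct_le _ _).trans ?_
  calc _ ≤ l2Norm v * (l2Norm a / (1 - ρ) * l2Norm v) :=
        mul_le_mul h1 (l2Norm_readout_mulVec_le hM hρ n a v) (l2Norm_nonneg _) (l2Norm_nonneg _)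
    _ = _ := by ring

lemma abs_dotProduct_readout_transpose_mul_le (hM : opNormTwo M ≤ ρ) (hρ : ρ < 1) (n : ℕ)
    (a b : Fin p → ℝ) (v : Fin n × Fin p → ℝ) :
    |v ⬝ᵥ ((readout M n a)ᵀ * readout M n b) *ᵥ v| ≤
      l2Norm a * l2Norm b / (1 - ρ) ^ 2 * ∑ s, v s ^ 2 := by
  have hd : 0 < 1 - ρ := by linarith
  rw [← Matrix.mulVec_mulVec, Matrix.dotProduct_mulVec, Matrix.vecMul_transpose, ← l2Norm_sq]
  refine (abs_dotProduct_le _ _).trans ?_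
  calc _ ≤ (l2Norm a / (1 - ρ) * l2Norm v) * (l2Norm b / (1 - ρ) * l2Norm v) :=
        mul_le_mul (l2Norm_readout_mulVec_le hM hρ n a v) (l2Norm_readout_mulVec_le hM hρ n b v)
          (l2Norm_nonneg _)
          (mul_nonneg (div_nonneg (l2Norm_nonneg _) hd.le) (l2Norm_nonneg _))
    _ = _ := by field_simp

lemma sum_readout_sq_le (hM : opNormTwo M ≤ ρ) (hρ : ρ < 1) (hΛ : Λ = 1 + M * Λ * Mᵀ) (n : ℕ)
    (a : Fin p → ℝ) : ∑ t, ∑ s, readout M n a t s ^ 2 ≤ n * (a ⬝ᵥ Λ *ᵥ a) := by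
  have h := sum_readout_mul_readout (M := M) n a a
  simp only [← sq, dotProduct_self_eq] at h
  rw [h]
  calc _ ≤ ∑ t ∈ Finset.range n, a ⬝ᵥ Λ *ᵥ a :=
        Finset.sum_le_sum fun t _ => sum_range_le_lyapunov hM hρ hΛ a t
    _ = _ := by simp

variable {Ω : Type*} [MeasurableSpace Ω] {μ : Measure Ω} [IsProbabilityMeasure μ]
  {W x : ℕ → Ω → Fin p → ℝ}
  (hM : opNormTwo M ≤ ρ) (hρ : ρ < 1) (hΛ : Λ = 1 + M * Λ * Mᵀ)
  (hW : iIndepFun (fun (s : ℕ × Fin p) ω => W s.1 ω s.2) μ)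
  (hlaw : ∀ t i, HasLaw (fun ω => W t ω i) (gaussianReal 0 1) μ)
  (h0 : ∀ ω, x 0 ω = 0) (hx : ∀ t ω, x (t + 1) ω = M *ᵥ x t ω + W t ω)
include hM hρ hΛ hW hlaw h0 hx

/-- Concentration of the correlation of the noise with a linear readout of the state. -/
lemma noise_readout_tail (n : ℕ) (i : Fin p) (a : Fin p → ℝ) {V t : ℝ}
    (hV : n * (a ⬝ᵥ Λ *ᵥ a) / 2 ≤ V) (hV0 : 0 < V) (ht : 0 ≤ t) :
    μ {ω | t ≤ |∑ s ∈ Finset.range n, W s ω i * (a ⬝ᵥ x s ω)|} ≤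
      ENNReal.ofReal (2 * Real.exp (-(t ^ 2 / (4 * V + 4 * (l2Norm a / (1 - ρ)) * t)))) := by
  have hd : 0 < 1 - ρ := by linarith
  have hinj : Function.Injective (fun s : Fin n × Fin p => ((s.1 : ℕ), s.2)) := by
    rintro ⟨s, i⟩ ⟨t, j⟩ h
    simpa [Fin.ext_iff] using h
  have h1 := gaussian_quadratic_abs_tail (hW.precomp hinj) (fun s => hlaw s.1 s.2)
    (abs_dotProduct_noiseReadout_le hM hρ n i a) (V := V) (t := t) ?_
    (div_nonneg (l2Norm_nonneg _) hd.le) hV0 ht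
  · refine le_of_eq_of_le ?_ h1
    congr 1
    ext ω
    simp only [Set.mem_ofPred_eq]
    rw [trace_noiseReadout, sub_zero, dotProduct_noiseReadout_mulVec, dotProduct]
    have h2 := readout_mulVec (W := fun s => W s ω) (x := fun s => x s ω) (h0 ω)
      (fun t => hx t ω) (n := n) a
    simp only [h2]
    rw [Fin.sum_univ_eq_sum_range (fun s => W s ω i * (a ⬝ᵥ x s ω))]
  · rw [sum_symPart_sq_eq _ (noiseReadout_mul_swap n i a), sum_noiseReadout_sq]
    have := sum_readout_sq_le hM hρ hΛ n a
    linarith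

/-- Concentration of the empirical covariance of two linear readouts of the state. -/
lemma readout_covariance_tail (n : ℕ) (a b : Fin p → ℝ) {V t τ : ℝ}
    (hV : (l2Norm a / (1 - ρ)) ^ 2 * (n * (b ⬝ᵥ Λ *ᵥ b)) ≤ V) (hV0 : 0 < V) (ht : 0 ≤ t)
    (hτ : t + l2Norm a * l2Norm b / (1 - ρ ^ 2) ^ 2 ≤ τ) :
    μ {ω | τ ≤ |∑ s ∈ Finset.range n, (a ⬝ᵥ x s ω) * (b ⬝ᵥ x s ω) - n * (a ⬝ᵥ Λ *ᵥ b)|} ≤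
      ENNReal.ofReal (2 * Real.exp (-(t ^ 2 /
        (4 * V + 4 * (l2Norm a * l2Norm b / (1 - ρ) ^ 2) * t)))) := by
  have hd : 0 < 1 - ρ := by linarith
  have hinj : Function.Injective (fun s : Fin n × Fin p => ((s.1 : ℕ), s.2)) := by
    rintro ⟨s, i⟩ ⟨t, j⟩ h
    simpa [Fin.ext_iff] using h
  have h1 := gaussian_quadratic_abs_tail (hW.precomp hinj) (fun s => hlaw s.1 s.2)
    (abs_dotProduct_readout_transpose_mul_le hM hρ n a b) (V := V) (t := t) ?_
    (div_nonneg (mul_nonneg (l2Norm_nonneg _) (l2Norm_nonneg _)) (sq_nonneg _)) hV0 ht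
  · refine (measure_mono fun ω hω => ?_).trans h1
    simp only [Set.mem_ofPred_eq] at hω ⊢
    have h2 := readout_mulVec (W := fun s => W s ω) (x := fun s => x s ω) (h0 ω)
      (fun t => hx t ω) (n := n)
    rw [← Matrix.mulVec_mulVec, Matrix.dotProduct_mulVec, Matrix.vecMul_transpose, dotProduct]
    simp only [h2]
    rw [Fin.sum_univ_eq_sum_range (fun s => (a ⬝ᵥ x s ω) * (b ⬝ᵥ x s ω))]
    have htr : ((readout M n a)ᵀ * readout M n b).trace =
        ∑ t, ∑ s, readout M n a t s * readout M n b t s := by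
      rw [Finset.sum_comm]
      simp [Matrix.trace, Matrix.mul_apply]
    rw [htr, sum_readout_mul_readout]
    have h4 := abs_lyapunov_sub_sum_range_le hM hρ hΛ a b n
    have h5 := abs_sub_le (∑ s ∈ Finset.range n, (a ⬝ᵥ x s ω) * (b ⬝ᵥ x s ω))
      (∑ t ∈ Finset.range n, ∑ m ∈ Finset.range t, (a ᵥ* M ^ m) ⬝ᵥ (b ᵥ* M ^ m))
      (n * (a ⬝ᵥ Λ *ᵥ b))
    linarith
  -- The operator norm is used for the readout of `a` and the Frobenius norm for that of `b`, so
  -- only the stationary variance of `b` enters `V`.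
  · refine (sum_symPart_sq_le _).trans ((sum_sq_transpose_mul_le
      (div_nonneg (l2Norm_nonneg a) hd.le) (l2Norm_readout_mulVec_le hM hρ n a)).trans ?_)
    exact (mul_le_mul_of_nonneg_left (sum_readout_sq_le hM hρ hΛ n b) (sq_nonneg _)).trans hV

end Tails

/-! ### Whitening and population regression on a support -/

section Blocks

variable {ι : Type*} [Fintype ι] [DecidableEq ι]

/-- Extension by zero of a vector indexed by `S`. -/
noncomputable def extendZero (S : Finset ι) (v : S → ℝ) : ι → ℝ :=
  fun j => if h : j ∈ S then v ⟨j, h⟩ else 0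

omit [Fintype ι] in
lemma extendZero_of_notMem {S : Finset ι} (v : S → ℝ) {j : ι} (hj : j ∉ S) :
    extendZero S v j = 0 := by simp [extendZero, hj]

omit [Fintype ι] in
lemma extendZero_coe {S : Finset ι} (v : S → ℝ) (s : S) : extendZero S v s = v s := by
  simp [extendZero]

omit [Fintype ι] in
lemma extendZero_restrict {S : Finset ι} {v : ι → ℝ} (hv : ∀ j ∉ S, v j = 0) :
    extendZero S (fun s => v s) = v := by
  ext j
  by_cases hj : j ∈ S
  · simp [extendZero, hj]
  · simp [extendZero, hj, hv j hj]

lemma sum_extendZero {S : Finset ι} (v : S → ℝ) (F : ι → ℝ → ℝ) (hF : ∀ j, F j 0 = 0) :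
    ∑ j, F j (extendZero S v j) = ∑ s : S, F s (v s) := by
  rw [← Finset.sum_subset (Finset.subset_univ S)
    (fun j _ hj => by rw [extendZero_of_notMem v hj, hF]), ← Finset.sum_coe_sort]
  simp only [extendZero_coe]

lemma l2Norm_extendZero {S : Finset ι} (v : S → ℝ) : l2Norm (extendZero S v) = l2Norm v := by
  have h : l2Norm (extendZero S v) ^ 2 = l2Norm v ^ 2 := by
    rw [l2Norm_sq, l2Norm_sq]
    exact sum_extendZero v (fun _ c => c ^ 2) (by simp)
  exact (sq_eq_sq₀ (l2Norm_nonneg _) (l2Norm_nonneg _)).1 h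

lemma mulVec_extendZero {S : Finset ι} (H : Matrix ι ι ℝ) (v : S → ℝ) (j : ι) :
    (H *ᵥ extendZero S v) j = ∑ s : S, H j s * v s :=
  sum_extendZero v (fun i c => H j i * c) (by simp)

lemma dotProduct_block_mulVec {S : Finset ι} (H : Matrix ι ι ℝ) (v w : S → ℝ) :
    extendZero S v ⬝ᵥ H *ᵥ extendZero S w = v ⬝ᵥ block H S S *ᵥ w := by
  rw [dotProduct, sum_extendZero v (fun j c => c * (H *ᵥ extendZero S w) j) (by simp)]
  simp only [mulVec_extendZero]
  rfl

omit [Fintype ι] [DecidableEq ι] in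
lemma block_isHermitian {H : Matrix ι ι ℝ} (hH : H.IsHermitian) (S : Finset ι) :
    (block H S S).IsHermitian := hH.submatrix _

/-- A basis of the vectors supported on `S` which is orthonormal for the form `H`. -/
lemma exists_whitening {H : Matrix ι ι ℝ} (hH : H.IsHermitian) (S : Finset ι) {C : ℝ}
    (hC : 0 < C) (hspec : ∀ c ∈ spectrum ℝ (block H S S), C ≤ c) :
    ∃ f : S → ι → ℝ, (∀ a, ∀ j ∉ S, f a j = 0) ∧
      (∀ a b, f a ⬝ᵥ H *ᵥ f b = if a = b then 1 else 0) ∧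
      (∀ v : ι → ℝ, (∀ j ∉ S, v j = 0) → ∃ c : S → ℝ, v = ∑ a, c a • f a) ∧
      (∀ v : ι → ℝ, (∀ j ∉ S, v j = 0) → C * l2Norm v ^ 2 ≤ v ⬝ᵥ H *ᵥ v) := by
  set hB := block_isHermitian hH S with hBdef
  have hpos : ∀ a, 0 < hB.eigenvalues a := fun a =>
    hC.trans_le (hspec _ (hB.eigenvalues_mem_spectrum_real a))
  have hexp : ∀ v : S → ℝ, v = WithLp.ofLp (∑ a, inner ℝ (hB.eigenvectorBasis a)
      (WithLp.toLp 2 v) • hB.eigenvectorBasis a) := by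
    intro v
    rw [hB.eigenvectorBasis.sum_repr' (WithLp.toLp 2 v)]
  -- Eigenvectors of the block divided by the square roots of their eigenvalues.
  refine ⟨fun a => extendZero S ((√(hB.eigenvalues a))⁻¹ • (hB.eigenvectorBasis a).ofLp),
    fun a j hj => extendZero_of_notMem _ hj, fun a b => ?_, fun v hv => ?_, fun v hv => ?_⟩
  · rw [dotProduct_block_mulVec, Matrix.mulVec_smul, hB.mulVec_eigenvectorBasis, dotProduct_smul,
      smul_dotProduct, dotProduct_smul]
    have h1 := EuclideanSpace.inner_eq_star_dotProduct
      (hB.eigenvectorBasis b) (hB.eigenvectorBasis a)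
    rw [star_trivial] at h1
    rw [← h1, orthonormal_iff_ite.1 hB.eigenvectorBasis.orthonormal]
    by_cases hab : a = b
    · subst hab
      have h2 := Real.sq_sqrt (hpos a).le
      have h3 : √(hB.eigenvalues a) ≠ 0 := (Real.sqrt_pos.2 (hpos a)).ne'
      simp only [if_true, smul_eq_mul, mul_one]
      field_simp
      exact h2.symm
    · simp [hab, Ne.symm hab]
  · refine ⟨fun a => √(hB.eigenvalues a) *
      inner ℝ (hB.eigenvectorBasis a) (WithLp.toLp 2 fun s : S => v s), ?_⟩
    conv_lhs => rw [← extendZero_restrict hv, hexp fun s : S => v s]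
    ext j
    by_cases hj : j ∈ S
    · have h3 : ∀ a, √(hB.eigenvalues a) ≠ 0 := fun a => (Real.sqrt_pos.2 (hpos a)).ne'
      simp only [extendZero, hj, dif_pos, WithLp.ofLp_sum, WithLp.ofLp_smul, Finset.sum_apply,
        Pi.smul_apply, smul_eq_mul]
      refine Finset.sum_congr rfl fun a _ => ?_
      field_simp [h3 a]
    · simp [extendZero, hj]
  · rw [← extendZero_restrict hv, dotProduct_block_mulVec, l2Norm_extendZero]
    set w : S → ℝ := fun s => v s
    have h1 := dotProduct_mulVec_eigenvectorBasis hB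
      (fun a => inner ℝ (hB.eigenvectorBasis a) (WithLp.toLp 2 w))
    rw [← hexp w] at h1
    rw [h1, l2Norm, ← hB.eigenvectorBasis.sum_sq_inner_right, Finset.mul_sum]
    exact Finset.sum_le_sum fun a _ => mul_le_mul_of_nonneg_right
      (hspec _ (hB.eigenvalues_mem_spectrum_real a)) (sq_nonneg _)

omit [DecidableEq ι] [Fintype ι] in
lemma sum_abs_row_le_opNormInf {κ σ : Type*} [Fintype κ] [Fintype σ] (M : Matrix κ σ ℝ) (j : κ) :
    ∑ s, |M j s| ≤ opNormInf M := by
  open scoped Matrix.Norms.Operator in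
  have h := Matrix.linfty_opNorm_def M
  have h2 : (∑ s, ‖M j s‖₊ : NNReal) ≤ Finset.univ.sup fun i => ∑ s, ‖M i s‖₊ :=
    Finset.le_sup (f := fun i => ∑ s, ‖M i s‖₊) (Finset.mem_univ j)
  rw [opNormInf, h]
  refine le_trans (le_of_eq ?_) (NNReal.coe_le_coe.2 h2)
  simp

/-- The population regression of the coordinate `j` on the coordinates in `S`. -/
lemma exists_regression {H : Matrix ι ι ℝ} (hH : H.IsHermitian) {S : Finset ι} {C κ : ℝ}
    (hC : 0 < C) (hspec : ∀ c ∈ spectrum ℝ (block H S S), C ≤ c)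
    (hinc : opNormInf (block H Sᶜ S * (block H S S)⁻¹) ≤ κ) {j : ι} (hj : j ∉ S) :
    ∃ b : ι → ℝ, (∀ i ∉ S, b i = 0) ∧ l1Norm b ≤ κ ∧
      ∀ v : ι → ℝ, (∀ i ∉ S, v i = 0) → (Pi.single j 1 - b) ⬝ᵥ H *ᵥ v = 0 := by
  have hB := block_isHermitian hH S
  have hdet : IsUnit (block H S S).det := by
    rw [isUnit_iff_ne_zero, hB.det_eq_prod_eigenvalues, Finset.prod_ne_zero_iff]
    intro a _
    have := hC.trans_le (hspec _ (hB.eigenvalues_mem_spectrum_real a))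
    simpa using this.ne'
  set R := block H Sᶜ S * (block H S S)⁻¹ with hR
  set j' : (Sᶜ : Finset ι) := ⟨j, Finset.mem_compl.2 hj⟩
  -- The regression coefficients are a row of `H_{SᶜS} H_SS⁻¹`, so the incoherence condition bounds
  -- their `ℓ¹` norm.
  refine ⟨extendZero S (R j'), fun i hi => extendZero_of_notMem _ hi, ?_, fun v hv => ?_⟩
  · rw [l1Norm, sum_extendZero (R j') (fun _ c => |c|) (by simp)]
    exact (sum_abs_row_le_opNormInf R j').trans hinc
  · rw [← extendZero_restrict hv, sub_dotProduct, dotProduct_block_mulVec,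
      single_one_dotProduct, mulVec_extendZero, Matrix.dotProduct_mulVec (R j')]
    have h1 : R j' ᵥ* block H S S = block H Sᶜ S j' := by
      have h2 : R * block H S S = block H Sᶜ S := by
        rw [hR, Matrix.mul_assoc, Matrix.nonsing_inv_mul _ hdet, Matrix.mul_one]
      ext s
      have := congrFun (congrFun h2 j') s
      exact this
    rw [h1]
    exact sub_self _

end Blocks

/-! ### The `ℓ¹` norm of sparse vectors -/

section L1

variable {ι : Type*} [Fintype ι]

lemma l1Norm_le_sqrt_card {S : Finset ι} {v : ι → ℝ} (hv : ∀ j ∉ S, v j = 0) {k : ℕ}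
    (hk : S.card ≤ k) : l1Norm v ≤ √k * l2Norm v := by
  have h1 : l1Norm v = ∑ j ∈ S, |v j| :=
    (Finset.sum_subset (Finset.subset_univ S) fun j _ hj => by simp [hv j hj]).symm
  have h2 := sq_sum_le_card_mul_sum_sq (s := S) (f := fun j => |v j|)
  have h3 : ∑ j ∈ S, |v j| ^ 2 ≤ l2Norm v ^ 2 := by
    rw [l2Norm_sq]
    simp only [sq_abs]
    exact Finset.sum_le_sum_of_subset_of_nonneg (Finset.subset_univ S) fun _ _ _ => sq_nonneg _
  refine le_of_sq_le_sq ?_ (mul_nonneg (Real.sqrt_nonneg _) (l2Norm_nonneg _))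
  rw [mul_pow, Real.sq_sqrt (Nat.cast_nonneg k), h1]
  refine h2.trans ?_
  have : (S.card : ℝ) ≤ k := by exact_mod_cast hk
  gcongr

lemma abs_dotProduct_le_mul_l1Norm {v w : ι → ℝ} {c : ℝ} (hw : ∀ j, |w j| ≤ c) :
    |v ⬝ᵥ w| ≤ c * l1Norm v := by
  rw [l1Norm, Finset.mul_sum]
  refine (Finset.abs_sum_le_sum_abs _ _).trans (Finset.sum_le_sum fun j _ => ?_)
  rw [abs_mul, mul_comm]
  exact mul_le_mul_of_nonneg_right (hw j) (abs_nonneg _)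

lemma l1Norm_add_le (v w : ι → ℝ) : l1Norm (v + w) ≤ l1Norm v + l1Norm w := by
  rw [l1Norm, l1Norm, l1Norm, ← Finset.sum_add_distrib]
  exact Finset.sum_le_sum fun j _ => abs_add_le _ _

end L1

/-! ### Perturbation from the population form to the sample form -/

section Sample

variable {ι : Type*} {Q : Matrix ι ι ℝ} {S : Finset ι} {k : ℕ} {f : S → ι → ℝ} {τ : ℝ}

lemma sum_abs_le_sqrt_mul_l2Norm (hk : S.card ≤ k) (c : S → ℝ) :
    ∑ a, |c a| ≤ √k * l2Norm c :=
  l1Norm_le_sqrt_card (S := Finset.univ) (by simp) (by simpa using hk)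

variable [Fintype ι]

lemma dotProduct_mulVec_sum_smul (g : ι → ℝ) (c : S → ℝ) :
    g ⬝ᵥ Q *ᵥ (∑ a, c a • f a) = ∑ a, c a * (g ⬝ᵥ Q *ᵥ f a) := by
  simp only [Matrix.mulVec_sum, dotProduct_sum, Matrix.mulVec_smul, dotProduct_smul, smul_eq_mul]

lemma sum_smul_dotProduct_mulVec (g : ι → ℝ) (c : S → ℝ) :
    (∑ a, c a • f a) ⬝ᵥ Q *ᵥ g = ∑ a, c a * (f a ⬝ᵥ Q *ᵥ g) := by
  simp only [sum_dotProduct, smul_dotProduct, smul_eq_mul]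

variable [DecidableEq ι]

lemma quadratic_sum_smul_eq {H : Matrix ι ι ℝ}
    (hf : ∀ a b, f a ⬝ᵥ H *ᵥ f b = if a = b then 1 else 0) (c : S → ℝ) :
    (∑ a, c a • f a) ⬝ᵥ H *ᵥ (∑ a, c a • f a) = l2Norm c ^ 2 := by
  rw [sum_smul_dotProduct_mulVec, l2Norm_sq]
  simp only [dotProduct_mulVec_sum_smul, hf]
  exact Finset.sum_congr rfl fun a _ => by simp; ring

/-- If the sample form is entrywise close to the identity in the basis `f`, it is positive definite
on the span of `f`. -/
lemma quadratic_sum_smul_ge (hk : S.card ≤ k)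
    (hf : ∀ a b, |f a ⬝ᵥ Q *ᵥ f b - if a = b then 1 else 0| ≤ τ) (hτ : 0 ≤ τ) (c : S → ℝ) :
    (1 - k * τ) * l2Norm c ^ 2 ≤ (∑ a, c a • f a) ⬝ᵥ Q *ᵥ (∑ a, c a • f a) := by
  set D : Matrix S S ℝ := Matrix.of fun a b => f a ⬝ᵥ Q *ᵥ f b - if a = b then 1 else 0 with hD
  have h1 : (∑ a, c a • f a) ⬝ᵥ Q *ᵥ (∑ a, c a • f a) = l2Norm c ^ 2 + c ⬝ᵥ D *ᵥ c := by
    rw [sum_smul_dotProduct_mulVec, l2Norm_sq, dotProduct, ← Finset.sum_add_distrib]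
    refine Finset.sum_congr rfl fun a _ => ?_
    rw [dotProduct_mulVec_sum_smul]
    simp only [hD, Matrix.mulVec, dotProduct, Matrix.of_apply, sub_mul,
      Finset.sum_sub_distrib, ite_mul, one_mul, zero_mul, Finset.sum_ite_eq, Finset.mem_univ,
      if_true]
    rw [mul_sub, sq, add_sub_cancel]
    congr 1
    exact Finset.sum_congr rfl fun b _ => mul_comm (c b) _
  have h2 : ∀ a, |(D *ᵥ c) a| ≤ τ * l1Norm c := fun a => by
    rw [Matrix.mulVec, dotProduct_comm]
    exact abs_dotProduct_le_mul_l1Norm fun b => hf a b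
  have h3 := abs_dotProduct_le_mul_l1Norm (v := c) h2
  have h4 : l1Norm c * l1Norm c ≤ k * l2Norm c ^ 2 := by
    have h5 := sum_abs_le_sqrt_mul_l2Norm hk c
    have h6 : 0 ≤ l1Norm c := Finset.sum_nonneg fun _ _ => abs_nonneg _
    calc l1Norm c * l1Norm c ≤ (√k * l2Norm c) * (√k * l2Norm c) :=
          mul_le_mul h5 h5 h6 (h6.trans h5)
      _ = (√k) ^ 2 * l2Norm c ^ 2 := by ring
      _ = _ := by rw [Real.sq_sqrt (Nat.cast_nonneg k)]
  have h7 := neg_abs_le (c ⬝ᵥ D *ᵥ c)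
  have h8 := mul_le_mul_of_nonneg_left h4 hτ
  rw [h1]
  nlinarith

/-- A vector which is nearly orthogonal to the span of `f` for the sample form becomes orthogonal
to it after a small correction. -/
lemma exists_sample_correction (hk : S.card ≤ k)
    (hf : ∀ a b, |f a ⬝ᵥ Q *ᵥ f b - if a = b then 1 else 0| ≤ τ) (hτ : 0 ≤ τ) (hkτ : k * τ < 1)
    {g : ι → ℝ} {σ : ℝ} (hσ : 0 ≤ σ) (hg : ∀ a, |g ⬝ᵥ Q *ᵥ f a| ≤ σ) (hsymm : Q.IsHermitian) :
    ∃ c : S → ℝ, (1 - k * τ) * l2Norm c ≤ √k * σ ∧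
      ∀ a, (g - ∑ b, c b • f b) ⬝ᵥ Q *ᵥ f a = 0 := by
  have hd : 0 < 1 - k * τ := by linarith
  set E : Matrix S S ℝ := Matrix.of fun a b => f a ⬝ᵥ Q *ᵥ f b with hE
  have hEc : ∀ c : S → ℝ, c ⬝ᵥ E *ᵥ c = (∑ a, c a • f a) ⬝ᵥ Q *ᵥ (∑ a, c a • f a) := by
    intro c
    rw [sum_smul_dotProduct_mulVec, dotProduct]
    refine Finset.sum_congr rfl fun a _ => ?_
    rw [dotProduct_mulVec_sum_smul]
    congr 1
    exact Finset.sum_congr rfl fun b _ => mul_comm _ _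
  -- Positive definiteness of the sample Gram matrix makes it invertible, so the normal equations
  -- for `c` are solvable; testing them against `c` itself bounds its length.
  have hinj : Function.Injective E.mulVec := by
    rw [← Matrix.coe_mulVecLin, injective_iff_map_eq_zero]
    intro c hc
    have h1 := quadratic_sum_smul_ge hk hf hτ c
    rw [← hEc c, show E *ᵥ c = 0 from hc, dotProduct_zero] at h1
    have h2 : l2Norm c ^ 2 = 0 := le_antisymm (by nlinarith) (sq_nonneg _)
    ext a
    have h3 : ∑ a, c a ^ 2 = 0 := by rw [← l2Norm_sq, h2]
    have h4 := (Finset.sum_eq_zero_iff_of_nonneg fun a _ => sq_nonneg (c a)).1 h3 a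
      (Finset.mem_univ a)
    simpa using h4
  obtain ⟨c, hc⟩ := (Matrix.mulVec_surjective_iff_isUnit.2
    (Matrix.mulVec_injective_iff_isUnit.1 hinj)) fun a => g ⬝ᵥ Q *ᵥ f a
  refine ⟨c, ?_, fun a => ?_⟩
  · have h1 := quadratic_sum_smul_ge hk hf hτ c
    have h2 : |c ⬝ᵥ E *ᵥ c| ≤ σ * l1Norm c := by
      rw [hc]
      exact abs_dotProduct_le_mul_l1Norm hg
    rw [← hEc c] at h1
    have h3 := sum_abs_le_sqrt_mul_l2Norm hk c
    rcases (l2Norm_nonneg c).eq_or_lt with h0 | h0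
    · rw [← h0, mul_zero]
      exact mul_nonneg (Real.sqrt_nonneg _) hσ
    · have h4 : (1 - k * τ) * l2Norm c * l2Norm c ≤ √k * σ * l2Norm c := by
        have h5 : σ * l1Norm c ≤ σ * (√k * l2Norm c) := mul_le_mul_of_nonneg_left h3 hσ
        nlinarith [le_abs_self (c ⬝ᵥ E *ᵥ c)]
      exact le_of_mul_le_mul_right h4 h0
  · have h1 := congrFun hc a
    have hsym : ∀ u v : ι → ℝ, u ⬝ᵥ Q *ᵥ v = v ⬝ᵥ Q *ᵥ u := fun u v => by
      have hQ : Qᵀ = Q := by simpa [Matrix.conjTranspose_eq_transpose_of_trivial] using hsymm.eq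
      rw [Matrix.dotProduct_mulVec, dotProduct_comm, ← Matrix.mulVec_transpose, hQ]
    rw [sub_dotProduct, sum_smul_dotProduct_mulVec, ← h1, sub_eq_zero]
    simp only [hE, Matrix.mulVec, dotProduct, Matrix.of_apply]
    refine Finset.sum_congr rfl fun b _ => ?_
    rw [mul_comm]
    congr 1
    exact hsym _ _

end Sample

/-! ### Deterministic analysis of lasso minimisers -/

lemma nonneg_of_forall_mul_add_sq_mul {a b : ℝ}
    (h : ∀ t : ℝ, 0 < t → t < 1 → 0 ≤ t * a + t ^ 2 * b) : 0 ≤ a := by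
  have h1 : Filter.Tendsto (fun t : ℝ => a + t * b) (nhdsWithin 0 (Set.Ioi 0)) (nhds a) := by
    have h2 : Continuous fun t : ℝ => a + t * b := by fun_prop
    simpa using (h2.tendsto 0).mono_left nhdsWithin_le_nhds
  refine ge_of_tendsto h1 ?_
  filter_upwards [Ioo_mem_nhdsGT (zero_lt_one (α := ℝ))] with t ht
  have h3 := h t ht.1 ht.2
  have h4 : t * a + t ^ 2 * b = t * (a + t * b) := by ring
  rw [h4] at h3
  exact nonneg_of_mul_nonneg_right h3 ht.1

section Lasso

variable {ι : Type*} [Fintype ι] {Q : Matrix ι ι ℝ}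

lemma dotProduct_mulVec_comm (hQ : Q.IsHermitian) (u v : ι → ℝ) :
    u ⬝ᵥ Q *ᵥ v = v ⬝ᵥ Q *ᵥ u := by
  have hQ' : Qᵀ = Q := by simpa [Matrix.conjTranspose_eq_transpose_of_trivial] using hQ.eq
  rw [Matrix.dotProduct_mulVec, dotProduct_comm, ← Matrix.mulVec_transpose, hQ']

/-- The `ℓ²` error of a lasso minimiser with the right support. -/
lemma lasso_error {S : Finset ι} {k : ℕ} (hk : S.card ≤ k) {G θ₀ θ : ι → ℝ}
    {lam γ C : ℝ} (hθ₀ : ∀ j ∉ S, θ₀ j = 0) (hθ : ∀ j ∉ S, θ j = 0) (hG : ∀ j, |G j| ≤ γ)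
    (hγ : 0 ≤ γ) (hlam : 0 ≤ lam)
    (hstat : ∀ j, |(G - Q *ᵥ (θ - θ₀)) j| ≤ lam)
    (hC : ∀ v : ι → ℝ, (∀ i ∉ S, v i = 0) → C * l2Norm v ^ 2 ≤ v ⬝ᵥ Q *ᵥ v) :
    C * l2Norm (θ - θ₀) ≤ √k * (γ + lam) := by
  set Δ := θ - θ₀ with hΔ
  have hΔS : ∀ j ∉ S, Δ j = 0 := fun j hj => by simp [hΔ, hθ₀ j hj, hθ j hj]
  have h1 := hC Δ hΔS
  -- By stationarity every entry of `Q *ᵥ Δ` is at most `γ + lam`; pairing it with `Δ` costs an `ℓ¹`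
  -- norm, hence `√k`.
  have h2 : |Δ ⬝ᵥ Q *ᵥ Δ| ≤ (γ + lam) * l1Norm Δ :=
    abs_dotProduct_le_mul_l1Norm fun j => by
      have h3 : (Q *ᵥ Δ) j = G j - (G - Q *ᵥ Δ) j := by simp
      rw [h3]
      exact (abs_sub _ _).trans (add_le_add (hG j) (hstat j))
  have h4 := mul_le_mul_of_nonneg_left (l1Norm_le_sqrt_card hΔS hk) (add_nonneg hγ hlam)
  rcases (l2Norm_nonneg Δ).eq_or_lt with h0 | h0
  · rw [← h0, mul_zero]
    exact mul_nonneg (Real.sqrt_nonneg _) (add_nonneg hγ hlam)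
  · refine le_of_mul_le_mul_right ?_ h0
    linarith [le_abs_self (Δ ⬝ᵥ Q *ᵥ Δ)]

variable [DecidableEq ι]

lemma l1Norm_add_single (θ : ι → ℝ) (j : ι) (c : ℝ) :
    l1Norm (θ + Pi.single j c) = l1Norm θ + (|θ j + c| - |θ j|) := by
  rw [l1Norm, l1Norm, ← sub_eq_iff_eq_add', ← Finset.sum_sub_distrib,
    Finset.sum_eq_single j]
  · simp
  · intro i _ hi
    simp [hi]
  · simp

/-- The first order optimality conditions of a lasso minimiser. -/
lemma lasso_stationary (hQ : Q.IsHermitian) {G θ₀ θ : ι → ℝ} {lam : ℝ} (hlam : 0 ≤ lam)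
    (hmin : ∀ θ' : ι → ℝ,
      1 / 2 * ((θ - θ₀) ⬝ᵥ Q *ᵥ (θ - θ₀)) - G ⬝ᵥ (θ - θ₀) + lam * l1Norm θ ≤
      1 / 2 * ((θ' - θ₀) ⬝ᵥ Q *ᵥ (θ' - θ₀)) - G ⬝ᵥ (θ' - θ₀) + lam * l1Norm θ') (j : ι) :
    |(G - Q *ᵥ (θ - θ₀)) j| ≤ lam ∧ lam * |θ j| ≤ (G - Q *ᵥ (θ - θ₀)) j * θ j := by
  set m := (G - Q *ᵥ (θ - θ₀)) j with hm
  have hdir : ∀ c : ℝ, 0 ≤ -c * m + c ^ 2 * (Q j j / 2) + lam * (|θ j + c| - |θ j|) := by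
    intro c
    have h1 := hmin (θ + Pi.single j c)
    have h2 : θ + Pi.single j c - θ₀ = (θ - θ₀) + c • Pi.single j 1 := by
      rw [← Pi.single_smul]
      simp [add_sub_right_comm]
    have h3 : (θ - θ₀) ⬝ᵥ Q *ᵥ Pi.single j 1 = (Q *ᵥ (θ - θ₀)) j := by
      rw [dotProduct_mulVec_comm hQ, single_one_dotProduct]
    have h4 : Pi.single j 1 ⬝ᵥ Q *ᵥ Pi.single j 1 = Q j j := by
      simp
    have h5 : Pi.single j 1 ⬝ᵥ Q *ᵥ (θ - θ₀) = (Q *ᵥ (θ - θ₀)) j := single_one_dotProduct _ _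
    have h6 : G ⬝ᵥ Pi.single j 1 = G j := dotProduct_single_one _ _
    rw [l1Norm_add_single, h2] at h1
    simp only [Matrix.mulVec_add, dotProduct_add, add_dotProduct, Matrix.mulVec_smul,
      dotProduct_smul, smul_dotProduct, smul_eq_mul, h3, h4, h5, h6] at h1
    have h7 : m = G j - (Q *ᵥ (θ - θ₀)) j := rfl
    rw [h7]
    linarith
  refine ⟨abs_le.2 ⟨?_, ?_⟩, ?_⟩
  · have h : 0 ≤ m + lam := nonneg_of_forall_mul_add_sq_mul (b := Q j j / 2) fun t ht _ => by
      have h1 := hdir (-t)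
      have h2 : |θ j + -t| - |θ j| ≤ t := by
        have := abs_add_le (θ j) (-t)
        rw [abs_neg, abs_of_pos ht] at this
        linarith
      have h3 := mul_le_mul_of_nonneg_left h2 hlam
      linarith
    linarith
  · have h : 0 ≤ -m + lam := nonneg_of_forall_mul_add_sq_mul (b := Q j j / 2) fun t ht _ => by
      have h1 := hdir t
      have h2 : |θ j + t| - |θ j| ≤ t := by
        have := abs_add_le (θ j) t
        rw [abs_of_pos ht] at this
        linarith
      have h3 := mul_le_mul_of_nonneg_left h2 hlam
      linarith
    linarith
  · have h : 0 ≤ θ j * m - lam * |θ j| :=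
      nonneg_of_forall_mul_add_sq_mul (b := θ j ^ 2 * (Q j j / 2)) fun t ht ht1 => by
        -- Shrinking the coordinate proportionally lowers the penalty by exactly `lam * t * |θ j|`,
        -- whatever its sign.
        have h1 := hdir (-t * θ j)
        have h2 : |θ j + -t * θ j| = (1 - t) * |θ j| := by
          rw [show θ j + -t * θ j = (1 - t) * θ j by ring, abs_mul,
            abs_of_pos (by linarith : 0 < 1 - t)]
        rw [h2] at h1
        linarith
    linarith

/-- Support recovery: if the sample regression of every coordinate outside `S` on the coordinates
in `S` has small `ℓ¹` norm, a lasso minimiser vanishes outside `S`. -/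
lemma lasso_support {S : Finset ι} (hpsd : ∀ v : ι → ℝ, 0 ≤ v ⬝ᵥ Q *ᵥ v) {G θ₀ θ : ι → ℝ}
    {lam γ κ : ℝ} (hθ₀ : ∀ j ∉ S, θ₀ j = 0) (hG : ∀ j, |G j| ≤ γ)
    (hstat : ∀ j, |(G - Q *ᵥ (θ - θ₀)) j| ≤ lam ∧ lam * |θ j| ≤ (G - Q *ᵥ (θ - θ₀)) j * θ j)
    (hreg : ∀ j ∉ S, ∃ b : ι → ℝ, (∀ i ∉ S, b i = 0) ∧ l1Norm b ≤ κ ∧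
      ∀ v : ι → ℝ, (∀ i ∉ S, v i = 0) → (Pi.single j 1 - b) ⬝ᵥ Q *ᵥ v = 0)
    (hlt : γ + κ * (γ + lam) < lam) : ∀ j ∉ S, θ j = 0 := by
  choose! b hbS hbκ hborth using hreg
  set Δ := θ - θ₀ with hΔ
  set m := G - Q *ᵥ Δ with hm
  have hΔS : ∀ j ∉ S, Δ j = θ j := fun j hj => by simp [hΔ, hθ₀ j hj]
  -- `y` is the part of `Δ` which is `Q`-orthogonal to the vectors supported on `S`, so `y ⬝ᵥ Q *ᵥ Δ
  -- = y ⬝ᵥ Q *ᵥ y ≥ 0`. Stationarity makes the same number at most a negative multiple of the `ℓ¹`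
  -- mass of `θ` outside `S`, which must therefore vanish.
  set y : ι → ℝ := ∑ j ∈ Sᶜ, θ j • (Pi.single j 1 - b j) with hy
  have hyS : ∀ i ∉ S, (Δ - y) i = 0 := by
    intro i hi
    have h1 : y i = θ i := by
      rw [hy, Finset.sum_apply, Finset.sum_eq_single_of_mem i (Finset.mem_compl.2 hi)]
      · simp [hbS i hi i hi]
      · intro j hj hji
        simp [hbS j (Finset.mem_compl.1 hj) i hi, Ne.symm hji]
    simp [h1, hΔS i hi]
  have hyorth : y ⬝ᵥ Q *ᵥ (Δ - y) = 0 := by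
    rw [hy, sum_dotProduct]
    refine Finset.sum_eq_zero fun j hj => ?_
    rw [smul_dotProduct, hborth j (Finset.mem_compl.1 hj) _ hyS, smul_zero]
  have hnonneg : 0 ≤ y ⬝ᵥ Q *ᵥ Δ := by
    have h1 := hpsd y
    rw [Matrix.mulVec_sub, dotProduct_sub] at hyorth
    linarith
  have hterm : ∀ j ∈ Sᶜ, θ j * ((Pi.single j 1 - b j) ⬝ᵥ Q *ᵥ Δ) ≤
      -(lam - (γ + κ * (γ + lam))) * |θ j| := by
    intro j hj
    have h1 : Q *ᵥ Δ = G - m := by rw [hm]; abel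
    have h2 : |b j ⬝ᵥ (G - m)| ≤ (γ + lam) * l1Norm (b j) :=
      abs_dotProduct_le_mul_l1Norm fun i => by
        have := abs_sub (G i) (m i)
        exact this.trans (add_le_add (hG i) (hstat i).1)
    have hγ : 0 ≤ γ := (abs_nonneg _).trans (hG j)
    have hl : 0 ≤ lam := (abs_nonneg _).trans (hstat j).1
    have h3 := mul_le_mul_of_nonneg_left (hbκ j (Finset.mem_compl.1 hj)) (add_nonneg hγ hl)
    have h4 : θ j * G j ≤ |θ j| * γ :=
      (le_abs_self _).trans (by rw [abs_mul]; gcongr; exact hG j)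
    have h5 : -(θ j * (b j ⬝ᵥ (G - m))) ≤ |θ j| * ((γ + lam) * κ) :=
      (neg_le_abs _).trans (by rw [abs_mul]; gcongr; exact h2.trans h3)
    have h6 := (hstat j).2
    rw [h1, sub_dotProduct, single_one_dotProduct, Pi.sub_apply]
    linarith
  have hsum : y ⬝ᵥ Q *ᵥ Δ ≤ -(lam - (γ + κ * (γ + lam))) * ∑ j ∈ Sᶜ, |θ j| := by
    rw [hy, sum_dotProduct, Finset.mul_sum]
    refine Finset.sum_le_sum fun j hj => ?_
    rw [smul_dotProduct, smul_eq_mul]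
    exact hterm j hj
  have h0 : 0 ≤ ∑ j ∈ Sᶜ, |θ j| := Finset.sum_nonneg fun _ _ => abs_nonneg _
  have h1 : ∑ j ∈ Sᶜ, |θ j| = 0 := le_antisymm (by nlinarith) h0
  intro j hj
  have := (Finset.sum_eq_zero_iff_of_nonneg fun _ _ => abs_nonneg _).1 h1 j
    (Finset.mem_compl.2 hj)
  simpa using this

end Lasso

/-! ### Sample second moments and expansion of the loss -/

section SampleMoment

variable {ι : Type*}

/-- The sample second moment matrix of the covariates `z 0, …, z (n - 1)`. -/
noncomputable def sampleMoment (n : ℕ) (z : ℕ → ι → ℝ) : Matrix ι ι ℝ :=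
  (1 / (n : ℝ)) • ∑ t ∈ Finset.range n, Matrix.vecMulVec (z t) (z t)

lemma sampleMoment_isHermitian (n : ℕ) (z : ℕ → ι → ℝ) : (sampleMoment n z).IsHermitian := by
  ext i j
  simp [sampleMoment, Matrix.sum_apply, Matrix.vecMulVec_apply, mul_comm]

variable [Fintype ι]

lemma dotProduct_sampleMoment_mulVec (n : ℕ) (z : ℕ → ι → ℝ) (u v : ι → ℝ) :
    u ⬝ᵥ sampleMoment n z *ᵥ v =
      (1 / (n : ℝ)) * ∑ t ∈ Finset.range n, (u ⬝ᵥ z t) * (v ⬝ᵥ z t) := by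
  rw [sampleMoment, Matrix.smul_mulVec, dotProduct_smul, smul_eq_mul, Matrix.sum_mulVec,
    dotProduct_sum]
  congr 1
  refine Finset.sum_congr rfl fun t _ => ?_
  rw [Matrix.vecMulVec_mulVec, dotProduct_smul, dotProduct_comm v]
  simp

lemma sampleMoment_nonneg (n : ℕ) (z : ℕ → ι → ℝ) (v : ι → ℝ) :
    0 ≤ v ⬝ᵥ sampleMoment n z *ᵥ v := by
  rw [dotProduct_sampleMoment_mulVec]
  exact mul_nonneg (by positivity) (Finset.sum_nonneg fun t _ => mul_self_nonneg _)

/-- The quadratic loss of a linear model, expanded around the true parameter. -/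
lemma squared_loss_eq (n : ℕ) (z : ℕ → ι → ℝ) (e : ℕ → ℝ) (θ₀ θ : ι → ℝ) :
    1 / (2 * (n : ℝ)) * ∑ t ∈ Finset.range n, (θ₀ ⬝ᵥ z t + e t - θ ⬝ᵥ z t) ^ 2 =
      1 / 2 * ((θ - θ₀) ⬝ᵥ sampleMoment n z *ᵥ (θ - θ₀)) -
        ((1 / (n : ℝ)) • ∑ t ∈ Finset.range n, e t • z t) ⬝ᵥ (θ - θ₀) +
        1 / (2 * (n : ℝ)) * ∑ t ∈ Finset.range n, e t ^ 2 := by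
  have h1 : ∀ t, (θ₀ ⬝ᵥ z t + e t - θ ⬝ᵥ z t) ^ 2 =
      ((θ - θ₀) ⬝ᵥ z t) * ((θ - θ₀) ⬝ᵥ z t) - 2 * (e t * (z t ⬝ᵥ (θ - θ₀))) + e t ^ 2 := by
    intro t
    rw [dotProduct_comm (z t), sub_dotProduct]
    ring
  simp only [h1]
  rw [dotProduct_sampleMoment_mulVec, smul_dotProduct, sum_dotProduct, Finset.sum_add_distrib,
    Finset.sum_sub_distrib, ← Finset.mul_sum]
  simp only [smul_dotProduct, smul_eq_mul]
  rw [← div_div]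
  ring

end SampleMoment

/-! ### Existence of minimisers -/

section Existence

variable {ι : Type*} [Fintype ι]

/-- A positive multiple of the `ℓ¹` norm makes the continuous objective coercive. -/
lemma exists_lasso_minimiser (F : (ι → ℝ) → ℝ) (hF : Continuous F) (hF0 : ∀ θ, 0 ≤ F θ)
    {lam : ℝ} (hlam : 0 < lam) :
    ∃ θ, ∀ θ', F θ + lam * l1Norm θ ≤ F θ' + lam * l1Norm θ' := by
  have hc : Continuous fun θ : ι → ℝ => F θ + lam * l1Norm θ := by
    simp only [l1Norm]
    fun_prop
  refine hc.exists_forall_le (Filter.tendsto_atTop_mono (fun θ => ?_)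
    ((tendsto_norm_cocompact_atTop (E := ι → ℝ)).const_mul_atTop hlam))
  have h1 : ‖θ‖ ≤ l1Norm θ := by
    refine (pi_norm_le_iff_of_nonneg (Finset.sum_nonneg fun _ _ => abs_nonneg _)).2 fun j => ?_
    exact Finset.single_le_sum (f := fun j => |θ j|) (fun _ _ => abs_nonneg _) (Finset.mem_univ j)
  nlinarith [hF0 θ, mul_le_mul_of_nonneg_left h1 hlam.le]

lemma exists_isLasso {p r : ℕ} (L : Matrix (Fin r) (Fin p) ℝ) (n : ℕ) {lam : ℝ}
    (hlam : 0 < lam) (x : ℕ → Fin p → ℝ) :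
    ∃ Θ : Matrix (Fin p) (Fin p ⊕ Fin r) ℝ, IsLasso L n lam x Θ := by
  have h : ∀ i, ∃ θ, ∀ θ', loss L n x i θ + lam * l1Norm θ ≤ loss L n x i θ' + lam * l1Norm θ' := by
    intro i
    refine exists_lasso_minimiser (loss L n x i) ?_ (fun θ => ?_) hlam
    · unfold loss
      simp only [dotProduct]
      fun_prop
    · unfold loss
      positivity
  choose Θ hΘ using h
  exact ⟨Θ, hΘ⟩

end Existence

/-! ### Consequences of the sample size condition -/

section SampleSize

variable {n k ℓ α D C ε K : ℝ}

/-- The sample size is a sum of two nonnegative terms. The one with `D ^ 3` controls the covariance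
deviations, the one with `ε ^ 2` the size of `lam`. -/
lemma sample_size_split (hα : 0 < α) (hD : 0 < D) (hC : 0 < C) (hε : 0 < ε) (hk : 1 ≤ k)
    (hK : 0 ≤ K)
    (hn : 4 * 10 ^ 3 * k ^ 2 * ℓ ^ 2 / (α ^ 2 * D * C ^ 2) * (1 / ε ^ 2 + k / D ^ 2) * K ≤ n) :
    4000 * k ^ 3 * ℓ ^ 2 * K ≤ n * α ^ 2 * D ^ 3 * C ^ 2 ∧
      4000 * k ^ 2 * ℓ ^ 2 * K ≤ n * α ^ 2 * D * C ^ 2 * ε ^ 2 := by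
  have h1 : 4 * 10 ^ 3 * k ^ 2 * ℓ ^ 2 / (α ^ 2 * D * C ^ 2) * (1 / ε ^ 2 + k / D ^ 2) * K =
      4000 * k ^ 3 * ℓ ^ 2 * K / (α ^ 2 * D ^ 3 * C ^ 2) +
      4000 * k ^ 2 * ℓ ^ 2 * K / (α ^ 2 * D * C ^ 2 * ε ^ 2) := by
    field_simp
    ring
  have hk0 : 0 < k := by linarith
  have h2 : 0 ≤ 4000 * k ^ 3 * ℓ ^ 2 * K / (α ^ 2 * D ^ 3 * C ^ 2) := by positivity
  have h3 : 0 ≤ 4000 * k ^ 2 * ℓ ^ 2 * K / (α ^ 2 * D * C ^ 2 * ε ^ 2) := by positivity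
  rw [h1] at hn
  constructor
  · have := (div_le_iff₀ (by positivity)).1 (show _ ≤ n by linarith :
      4000 * k ^ 3 * ℓ ^ 2 * K / (α ^ 2 * D ^ 3 * C ^ 2) ≤ n)
    linarith
  · have := (div_le_iff₀ (by positivity)).1 (show _ ≤ n by linarith :
      4000 * k ^ 2 * ℓ ^ 2 * K / (α ^ 2 * D * C ^ 2 * ε ^ 2) ≤ n)
    linarith

lemma sample_size_mul_gap (hα : 0 < α) (hα1 : α ≤ 1) (hD : 0 < D) (hC : 0 < C) (hDC : D * C ≤ 1)
    (hk : 1 ≤ k) (hℓ : 1 ≤ ℓ) (hK : 0 ≤ K) (hn0 : 0 < n)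
    (hn : 4000 * k ^ 3 * ℓ ^ 2 * K ≤ n * α ^ 2 * D ^ 3 * C ^ 2) :
    4000 * K ≤ n * D := by
  have h1 : (4000 : ℝ) * 1 ^ 3 * 1 ^ 2 * K ≤ 4000 * k ^ 3 * ℓ ^ 2 * K := by gcongr
  have h2 : n * α ^ 2 * D ^ 3 * C ^ 2 = n * D * (α ^ 2 * (D * C) ^ 2) := by ring
  have h3 : α ^ 2 * (D * C) ^ 2 ≤ 1 :=
    mul_le_one₀ (pow_le_one₀ hα.le hα1) (sq_nonneg _) (pow_le_one₀ (by positivity) hDC)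
  have h4 : n * D * (α ^ 2 * (D * C) ^ 2) ≤ n * D * 1 :=
    mul_le_mul_of_nonneg_left h3 (by positivity)
  linarith

/-- After cancelling `n * ℓ ^ 2 * K / D` the claim is `4 + 96 / 5 * s ≤ 144 / 25`, and the sample
size gives `s ≤ 1 / 60`. -/
lemma noise_exponent (hD : 0 < D) (hℓ : 1 ≤ ℓ) (hK : 0 < K) (hn0 : 0 < n)
    (hn : 4000 * K ≤ n * D) :
    2 * K ≤ (n * (12 / 5 * ℓ * √(K / (n * D)))) ^ 2 /
      (4 * (n * ℓ ^ 2 / (2 * D)) + 4 * (ℓ / D) * (n * (12 / 5 * ℓ * √(K / (n * D))))) := by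
  set s := √(K / (n * D)) with hs
  have hs0 : 0 ≤ s := Real.sqrt_nonneg _
  have hs2 : s ^ 2 * (n * D) = K := by
    rw [hs, Real.sq_sqrt (by positivity)]
    field_simp
  have hs1 : s ≤ 1 / 60 := by
    refine Real.sqrt_le_iff.2 ⟨by norm_num, ?_⟩
    rw [div_le_iff₀ (by positivity)]
    linarith
  rw [le_div_iff₀ (by positivity)]
  have h1 : 2 * K * (4 * (n * ℓ ^ 2 / (2 * D)) + 4 * (ℓ / D) * (n * (12 / 5 * ℓ * s))) =
      (n * ℓ ^ 2 * K / D) * (4 + 96 / 5 * s) := by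
    field_simp
    ring
  have h2 : (n * (12 / 5 * ℓ * s)) ^ 2 = (n * ℓ ^ 2 * K / D) * (144 / 25) := by
    rw [← hs2]
    field_simp
    ring
  rw [h1, h2]
  exact mul_le_mul_of_nonneg_left (by linarith) (by positivity)

/-- `R` and `F` bound the readouts of the two test vectors. One hundredth of the threshold `n * τ`
absorbs the bias of starting at rest, and the rest is the deviation. The formula for `τ` covers both
kinds of pairs: `R = F` gives `α / (20 * k)`, and `R = 2 * ℓ` gives `α * √C / (10 * k * √k)`. -/
lemma covariance_exponent {R F : ℝ} (hα : 0 < α) (hα1 : α ≤ 1) (hD : 0 < D) (hC : 0 < C)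
    (hDC : D * C ≤ 1) (hk : 1 ≤ k) (hℓ : 1 ≤ ℓ) (hK : 1 ≤ K) (hn0 : 0 < n) (hR : 0 < R)
    (hF : F = √k * ℓ / √C)
    (hn : 4000 * k ^ 3 * ℓ ^ 2 * K ≤ n * α ^ 2 * D ^ 3 * C ^ 2) {τ : ℝ}
    (hτ : τ = R * α * √C / (20 * ℓ * k * √k)) :
    99 / 100 * (n * τ) + R * F / D ^ 2 ≤ n * τ ∧
      2 * K ≤ (99 / 100 * (n * τ)) ^ 2 /
        (4 * ((R / D) ^ 2 * n) + 4 * (R * F / D ^ 2) * (99 / 100 * (n * τ))) := by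
  have hk0 : 0 < k := by linarith
  have hℓ0 : 0 < ℓ := by linarith
  have hK0 : 0 < K := by linarith
  obtain ⟨c, hc0, hc⟩ : ∃ c, 0 < c ∧ √C = c := ⟨_, Real.sqrt_pos.2 hC, rfl⟩
  obtain ⟨q, hq0, hq⟩ : ∃ q, 0 < q ∧ √k = q := ⟨_, Real.sqrt_pos.2 hk0, rfl⟩
  have hc2 : C = c ^ 2 := by rw [← hc, Real.sq_sqrt hC.le]
  have hq2 : k = q ^ 2 := by rw [← hq, Real.sq_sqrt hk0.le]
  rw [hc, hq] at hF hτ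
  have hτ0 : 0 < τ := by rw [hτ]; positivity
  have hF0 : 0 < F := by rw [hF]; positivity
  have hFτ : F * τ = R * (α / (20 * k)) := by
    rw [hF, hτ]; field_simp
  have hτ2 : τ ^ 2 = R ^ 2 * α ^ 2 * C / (400 * ℓ ^ 2 * k ^ 3) := by
    rw [hτ, hc2, hq2]; field_simp; norm_num
  constructor
  · have h1 : R * F / D ^ 2 = n * τ * (F ^ 2 / (n * D ^ 2 * (α / (20 * k)))) := by
      rw [show n * τ * (F ^ 2 / (n * D ^ 2 * (α / (20 * k)))) =
        n * F * (F * τ) / (n * D ^ 2 * (α / (20 * k))) by ring, hFτ]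
      field_simp
    have h2 : F ^ 2 = k * ℓ ^ 2 / C := by
      rw [hF, hc2, hq2]; field_simp
    have h3 : F ^ 2 / (n * D ^ 2 * (α / (20 * k))) ≤ 1 / 100 := by
      rw [h2, div_le_iff₀ (by positivity), div_le_iff₀ hC]
      have h4 : 4000 * k ^ 2 * ℓ ^ 2 ≤ n * α * D ^ 2 * C := by
        have h5 : (4000 : ℝ) * k ^ 2 * ℓ ^ 2 * (1 * 1) ≤ 4000 * k ^ 2 * ℓ ^ 2 * (k * K) := by
          gcongr
        have h6 : n * α ^ 2 * D ^ 3 * C ^ 2 = n * α * D ^ 2 * C * (α * (D * C)) := by ring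
        have h7 : n * α * D ^ 2 * C * (α * (D * C)) ≤ n * α * D ^ 2 * C * 1 :=
          mul_le_mul_of_nonneg_left (mul_le_one₀ hα1 (by positivity) hDC) (by positivity)
        linarith
      have h8 : 1 / 100 * (n * D ^ 2 * (α / (20 * k))) * C =
          (n * α * D ^ 2 * C) / (2000 * k) := by
        field_simp; ring
      rw [h8, le_div_iff₀ (by positivity)]
      have : 0 ≤ k ^ 2 * ℓ ^ 2 := by positivity
      linarith
    have h9 := mul_le_mul_of_nonneg_left h3 (by positivity : 0 ≤ n * τ)
    rw [h1]
    linarith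
  · rw [le_div_iff₀ (by positivity)]
    have h1 : 4 * ((R / D) ^ 2 * n) + 4 * (R * F / D ^ 2) * (99 / 100 * (n * τ)) ≤
        21 / 5 * (R ^ 2 * n / D ^ 2) := by
      have h2 : 4 * (R * F / D ^ 2) * (99 / 100 * (n * τ)) =
          (R ^ 2 * n / D ^ 2) * (99 / 500 * (α / k)) := by
        rw [show 4 * (R * F / D ^ 2) * (99 / 100 * (n * τ)) =
          99 / 25 * (R / D ^ 2) * n * (F * τ) by ring, hFτ]
        field_simp
        ring
      have h3 : α / k ≤ 1 := (div_le_one hk0).2 (by linarith)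
      have h4 : (R ^ 2 * n / D ^ 2) * (99 / 500 * (α / k)) ≤ (R ^ 2 * n / D ^ 2) * (1 / 5) :=
        mul_le_mul_of_nonneg_left (by linarith) (by positivity)
      have h5 : 4 * ((R / D) ^ 2 * n) = 4 * (R ^ 2 * n / D ^ 2) := by ring
      rw [h2, h5]
      linarith
    refine (mul_le_mul_of_nonneg_left h1 (by positivity)).trans ?_
    have h6 : (99 / 100 * (n * τ)) ^ 2 =
        (R ^ 2 * n / D ^ 2) * (9801 / 4000000 * (n * α ^ 2 * C * D ^ 2 / (ℓ ^ 2 * k ^ 3))) := by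
      rw [show (99 / 100 * (n * τ)) ^ 2 = 9801 / 10000 * n ^ 2 * τ ^ 2 by ring, hτ2]
      field_simp
      norm_num
    have h7 : 4000 * K ≤ n * α ^ 2 * C * D ^ 2 / (ℓ ^ 2 * k ^ 3) := by
      rw [le_div_iff₀ (by positivity)]
      have h8 : n * α ^ 2 * D ^ 3 * C ^ 2 = n * α ^ 2 * C * D ^ 2 * (D * C) := by ring
      have h9 : n * α ^ 2 * C * D ^ 2 * (D * C) ≤ n * α ^ 2 * C * D ^ 2 * 1 :=
        mul_le_mul_of_nonneg_left hDC (by positivity)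
      linarith
    rw [h6, show 2 * K * (21 / 5 * (R ^ 2 * n / D ^ 2)) =
      (R ^ 2 * n / D ^ 2) * (42 / 5 * K) by ring]
    exact mul_le_mul_of_nonneg_left (by linarith) (by positivity)

lemma regularization_le {s lam : ℝ} (hα : 0 < α) (hD : 0 < D) (hC : 0 < C) (hε : 0 < ε)
    (hk : 1 ≤ k) (hℓ : 1 ≤ ℓ) (hn0 : 0 < n) (hs : 0 ≤ s) (hsK : s ≤ K)
    (hn : 4000 * k ^ 2 * ℓ ^ 2 * K ≤ n * α ^ 2 * D * C ^ 2 * ε ^ 2)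
    (hlam : lam = 6 * ℓ * √(s / (n * α ^ 2 * D))) : lam ≤ C * ε / (10 * k) := by
  have hk0 : 0 < k := by linarith
  have hℓ0 : 0 < ℓ := by linarith
  refine le_of_sq_le_sq ?_ (by positivity)
  rw [hlam, mul_pow, Real.sq_sqrt (by positivity), div_pow, mul_div_assoc', div_le_div_iff₀
    (by positivity) (by positivity)]
  have h1 : 4000 * k ^ 2 * ℓ ^ 2 * s ≤ 4000 * k ^ 2 * ℓ ^ 2 * K := by gcongr
  have h2 : 0 ≤ k ^ 2 * ℓ ^ 2 * s := by positivity
  nlinarith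

end SampleSize

/-! ### The deterministic bound for one row -/

/-- Deterministic error bound for the lasso: if the noise is nearly uncorrelated with the
covariates, and the sample second moments `Q` are close to `H` on a basis of the vectors supported
on `S` and on the residuals of the population regressions on `S`, a lasso minimiser is close to
the true parameter. -/
lemma lasso_row_error {ι : Type*} [Fintype ι] [DecidableEq ι] {Q H : Matrix ι ι ℝ}
    (hQ : Q.IsHermitian) (hpsd : ∀ v : ι → ℝ, 0 ≤ v ⬝ᵥ Q *ᵥ v) {S : Finset ι} {k : ℕ}
    (hk : S.card ≤ k) (hk1 : 1 ≤ k) {C α ε lam : ℝ} (hC : 0 < C) (hα : 0 < α) (hα1 : α ≤ 1)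
    (hε : 0 < ε) (hlam : 0 < lam) (hlamC : lam ≤ C * ε / (10 * k))
    {f : S → ι → ℝ} (hfS : ∀ a, ∀ j ∉ S, f a j = 0)
    (hfH : ∀ a b, f a ⬝ᵥ H *ᵥ f b = if a = b then 1 else 0)
    (hfspan : ∀ v : ι → ℝ, (∀ j ∉ S, v j = 0) → ∃ c : S → ℝ, v = ∑ a, c a • f a)
    (hCH : ∀ v : ι → ℝ, (∀ j ∉ S, v j = 0) → C * l2Norm v ^ 2 ≤ v ⬝ᵥ H *ᵥ v)
    {b : ι → ι → ℝ} (hbS : ∀ j ∉ S, ∀ i ∉ S, b j i = 0) (hb : ∀ j ∉ S, l1Norm (b j) ≤ 1 - α)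
    {G θ₀ θ : ι → ℝ} (hθ₀ : ∀ j ∉ S, θ₀ j = 0) (hG : ∀ j, |G j| ≤ 2 / 5 * (α * lam))
    (hff : ∀ a c, |f a ⬝ᵥ Q *ᵥ f c - if a = c then 1 else 0| ≤ α / (20 * k))
    (hrf : ∀ j ∉ S, ∀ a, |(Pi.single j 1 - b j) ⬝ᵥ Q *ᵥ f a| ≤ α * √C / (10 * k * √k))
    (hmin : ∀ θ' : ι → ℝ,
      1 / 2 * ((θ - θ₀) ⬝ᵥ Q *ᵥ (θ - θ₀)) - G ⬝ᵥ (θ - θ₀) + lam * l1Norm θ ≤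
      1 / 2 * ((θ' - θ₀) ⬝ᵥ Q *ᵥ (θ' - θ₀)) - G ⬝ᵥ (θ' - θ₀) + lam * l1Norm θ') :
    l2Norm (θ - θ₀) ≤ ε := by
  have hkr : (1 : ℝ) ≤ k := by exact_mod_cast hk1
  have hk0 : (0 : ℝ) < k := by linarith
  have hsk : 0 < √(k : ℝ) := Real.sqrt_pos.2 hk0
  have hsk1 : 1 ≤ √(k : ℝ) := Real.one_le_sqrt.2 hkr
  have hsk2 : √(k : ℝ) ^ 2 = k := Real.sq_sqrt hk0.le
  have hsC : 0 < √C := Real.sqrt_pos.2 hC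
  have hsC2 : √C ^ 2 = C := Real.sq_sqrt hC.le
  have hτ : 0 ≤ α / (20 * k) := by positivity
  have hkτ : (k : ℝ) * (α / (20 * k)) = α / 20 := by field_simp
  have hstat := lasso_stationary hQ hlam.le hmin
  have hsupp : ∀ j ∉ S, θ j = 0 := by
    -- The correction has `ℓ¹` norm at most `20 / 19 * (α / 10) < α / 8`, which degrades `1 - α` to
    -- `1 - 7 / 8 * α`. With `γ = 2 / 5 * α * lam` this still satisfies the strict inequality for
    -- support recovery.
    refine lasso_support hpsd hθ₀ hG hstat (κ := 1 - 7 / 8 * α) (fun j hj => ?_) ?_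
    · obtain ⟨c, hc, horth⟩ := exists_sample_correction hk hff hτ (by rw [hkτ]; linarith)
        (by positivity) (hrf j hj) hQ
      set v := ∑ a, c a • f a with hv
      have hvS : ∀ i ∉ S, v i = 0 := fun i hi => by
        rw [hv, Finset.sum_apply]
        exact Finset.sum_eq_zero fun a _ => by simp [hfS a i hi]
      refine ⟨b j + v, fun i hi => by simp [hbS j hj i hi, hvS i hi], ?_, fun u hu => ?_⟩
      · have h1 := hCH v hvS
        rw [hv, quadratic_sum_smul_eq hfH, ← hv] at h1
        have h2 : √C * l2Norm v ≤ l2Norm c := by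
          refine le_of_sq_le_sq ?_ (l2Norm_nonneg _)
          rwa [mul_pow, hsC2]
        have h3 := l1Norm_le_sqrt_card hvS hk
        rw [hkτ] at hc
        have h4 : √(k : ℝ) * (α * √C / (10 * k * √k)) = α * √C / (10 * k) := by field_simp
        rw [h4] at hc
        have h5 : 19 / 20 * (√C * l2Norm v) ≤ √C * (α / (10 * k)) := by
          have h6 : 0 ≤ l2Norm c := l2Norm_nonneg _
          have h7 : √C * (α / (10 * k)) = α * √C / (10 * k) := by ring
          rw [h7]
          nlinarith
        have h8 : 19 / 20 * l2Norm v ≤ α / (10 * k) := by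
          refine le_of_mul_le_mul_left ?_ hsC
          linarith
        have h9 : √(k : ℝ) * (α / (10 * k)) ≤ α / 10 := by
          rw [mul_div_assoc', div_le_div_iff₀ (by positivity) (by norm_num)]
          have : √(k : ℝ) ≤ k := by nlinarith
          nlinarith
        have h10 := mul_le_mul_of_nonneg_left h8 hsk.le
        have h11 := l1Norm_add_le (b j) v
        have h12 := hb j hj
        linarith
      · obtain ⟨d, rfl⟩ := hfspan u hu
        rw [← sub_sub, dotProduct_mulVec_sum_smul]
        exact Finset.sum_eq_zero fun a _ => by rw [horth a, mul_zero]
    · nlinarith [mul_pos hα hlam, mul_pos hα (mul_pos hα hlam)]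
  have herr := lasso_error (C := 19 / 20 * C) hk hθ₀ hsupp hG (by positivity) hlam.le
    (fun j => (hstat j).1) fun v hv => by
      obtain ⟨c, rfl⟩ := hfspan v hv
      have h1 := quadratic_sum_smul_ge hk hff hτ c
      have h2 := hCH _ hv
      rw [quadratic_sum_smul_eq hfH] at h2
      rw [hkτ] at h1
      nlinarith [sq_nonneg (l2Norm c)]
  have h1 : √(k : ℝ) * (2 / 5 * (α * lam) + lam) ≤ √(k : ℝ) * (7 / 5 * (C * ε / (10 * k))) := by
    refine mul_le_mul_of_nonneg_left ?_ hsk.le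
    nlinarith
  have h2 : √(k : ℝ) * (7 / 5 * (C * ε / (10 * k))) ≤ 19 / 20 * C * ε := by
    have h3 : √(k : ℝ) / k ≤ 1 := (div_le_one hk0).2 (by nlinarith)
    have h4 : √(k : ℝ) * (7 / 5 * (C * ε / (10 * k))) = 7 / 50 * (C * ε) * (√(k : ℝ) / k) := by
      field_simp
      norm_num
    rw [h4]
    have h5 : 0 < C * ε := by positivity
    nlinarith
  exact le_of_mul_le_mul_left (herr.trans (h1.trans h2)) (by positivity)

/-! ### Bounds for the extended gain -/

section Gain

variable {p r : ℕ} {L : Matrix (Fin r) (Fin p) ℝ}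

lemma one_le_gainBound : 1 ≤ gainBound L := le_max_left _ _

lemma l2Norm_extendedGain_inl (i : Fin p) : l2Norm (extendedGain L (Sum.inl i)) = 1 := by
  have h : extendedGain L (Sum.inl i) = Pi.single i 1 := by
    ext c
    simp [extendedGain, Matrix.one_apply, Pi.single_apply, eq_comm]
  rw [h, l2Norm]
  simp

lemma l2Norm_extendedGain_le (j : Fin p ⊕ Fin r) : l2Norm (extendedGain L j) ≤ gainBound L := by
  rcases j with i | j
  · rw [l2Norm_extendedGain_inl]
    exact one_le_gainBound
  · have h : extendedGain L (Sum.inr j) = -L j := rfl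
    rw [h, l2Norm_neg]
    exact (le_ciSup (Set.finite_range fun j => l2Norm (L j)).bddAbove j).trans (le_max_right _ _)

/-- The left side is a combination of rows of `L̃`, each of length at most `ℓ`; the `ℓ¹` norm thus
converts test vectors into readouts. -/
lemma l2Norm_vecMul_extendedGain_le (f : Fin p ⊕ Fin r → ℝ) :
    l2Norm (f ᵥ* extendedGain L) ≤ gainBound L * l1Norm f := by
  rw [Matrix.vecMul_eq_sum, l1Norm, Finset.mul_sum]
  refine (l2Norm_sum_le _ _).trans (Finset.sum_le_sum fun j _ => ?_)
  rw [l2Norm_smul, mul_comm]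
  exact mul_le_mul_of_nonneg_right (l2Norm_extendedGain_le j) (abs_nonneg _)

lemma dotProduct_extendedGain_form (Λ : Matrix (Fin p) (Fin p) ℝ) (f g : Fin p ⊕ Fin r → ℝ) :
    f ⬝ᵥ (extendedGain L * Λ * (extendedGain L)ᵀ) *ᵥ g =
      (f ᵥ* extendedGain L) ⬝ᵥ Λ *ᵥ (g ᵥ* extendedGain L) := by
  rw [← Matrix.mulVec_mulVec, ← Matrix.mulVec_mulVec, Matrix.mulVec_transpose,
    Matrix.dotProduct_mulVec]

lemma interaction_mul_extendedGain (A : Matrix (Fin p) (Fin p) ℝ) (B : Matrix (Fin p) (Fin r) ℝ)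
    (L : Matrix (Fin r) (Fin p) ℝ) : interaction A B * extendedGain L = A - B * L := by
  rw [interaction, extendedGain, Matrix.fromCols_mul_fromRows]
  simp [sub_eq_add_neg]

lemma IsLyapunovSolution.eq {A : Matrix (Fin p) (Fin p) ℝ} {B : Matrix (Fin p) (Fin r) ℝ}
    {Λ : Matrix (Fin p) (Fin p) ℝ} (h : IsLyapunovSolution (interaction A B) L Λ) :
    Λ = 1 + (A - B * L) * Λ * (A - B * L)ᵀ := by
  rw [← interaction_mul_extendedGain, Matrix.transpose_mul, ← Matrix.mul_assoc]
  exact eq_add_of_sub_eq h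

end Gain

lemma measure_iUnion_le_card_mul {Ω ι : Type*} [MeasurableSpace Ω] [Fintype ι] {μ : Measure Ω}
    {s : ι → Set Ω} {c : ℝ} (h : ∀ i, μ (s i) ≤ ENNReal.ofReal c) :
    μ (⋃ i, s i) ≤ ENNReal.ofReal (Fintype.card ι * c) := by
  refine (measure_iUnion_fintype_le μ s).trans ((Finset.sum_le_sum fun i _ => h i).trans ?_)
  rw [Finset.sum_const, nsmul_eq_mul, ENNReal.ofReal_mul (Nat.cast_nonneg _),
    ENNReal.ofReal_natCast, Finset.card_univ]

/-! ### Concentration for the covariates and the event for one row -/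

section System

variable {p r : ℕ} {L : Matrix (Fin r) (Fin p) ℝ} {M Λ : Matrix (Fin p) (Fin p) ℝ} {ρ : ℝ}
  (hM : opNormTwo M ≤ ρ) (hρ : ρ < 1) (hΛ : Λ = 1 + M * Λ * Mᵀ)
include hM hρ hΛ

lemma form_isHermitian :
    (extendedGain L * Λ * (extendedGain L)ᵀ).IsHermitian := by
  have h : Λᵀ = Λ := by
    ext i j
    have h1 := lyapunov_symm hM hρ hΛ (Pi.single j 1) (Pi.single i 1)
    simpa using h1
  rw [Matrix.IsHermitian, Matrix.conjTranspose_eq_transpose_of_trivial, Matrix.transpose_mul,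
    Matrix.transpose_mul, h, Matrix.transpose_transpose, Matrix.mul_assoc]

variable {Ω : Type*} [MeasurableSpace Ω] {μ : Measure Ω} [IsProbabilityMeasure μ]
  {W x : ℕ → Ω → Fin p → ℝ}
  (hW : iIndepFun (fun (s : ℕ × Fin p) ω => W s.1 ω s.2) μ)
  (hlaw : ∀ t i, HasLaw (fun ω => W t ω i) (gaussianReal 0 1) μ)
  (h0 : ∀ ω, x 0 ω = 0) (hx : ∀ t ω, x (t + 1) ω = M *ᵥ x t ω + W t ω)
include hW hlaw h0 hx

/-- Concentration of the sample second moments of the covariates. -/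
lemma sampleMoment_tail {n k : ℕ} {α C K R τ : ℝ} (hα : 0 < α) (hα1 : α ≤ 1) (hC : 0 < C)
    (hDC : (1 - ρ) * C ≤ 1) (hk : 1 ≤ k) (hK : 1 ≤ K) (hn0 : 0 < n) (hR : 0 < R)
    (hn : 4000 * (k : ℝ) ^ 3 * gainBound L ^ 2 * K ≤ n * α ^ 2 * (1 - ρ) ^ 3 * C ^ 2)
    (hτ : τ = R * α * √C / (20 * gainBound L * k * √k)) {g f : Fin p ⊕ Fin r → ℝ}
    (hg : l2Norm (g ᵥ* extendedGain L) ≤ R)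
    (hf : l2Norm (f ᵥ* extendedGain L) ≤ √k * gainBound L / √C)
    (hfH : f ⬝ᵥ (extendedGain L * Λ * (extendedGain L)ᵀ) *ᵥ f = 1) :
    μ {ω | τ ≤ |g ⬝ᵥ sampleMoment n (fun t => extendedGain L *ᵥ x t ω) *ᵥ f -
        g ⬝ᵥ (extendedGain L * Λ * (extendedGain L)ᵀ) *ᵥ f|} ≤
      ENNReal.ofReal (2 * Real.exp (-(2 * K))) := by
  have hρ0 : 0 ≤ ρ := (opNormTwo_nonneg M).trans hM
  have hD : 0 < 1 - ρ := by linarith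
  have hn0' : (0 : ℝ) < n := by exact_mod_cast hn0
  have hℓ := one_le_gainBound (L := L)
  have hℓ0 : 0 < gainBound L := by linarith
  have hk0 : (0 : ℝ) < k := by exact_mod_cast hk
  have hτ0 : 0 < τ := by rw [hτ]; positivity
  obtain ⟨hbias, hexp⟩ := covariance_exponent hα hα1 hD hC hDC (by exact_mod_cast hk) hℓ hK hn0'
    hR rfl hn hτ
  have hRF : l2Norm (g ᵥ* extendedGain L) * l2Norm (f ᵥ* extendedGain L) ≤
      R * (√k * gainBound L / √C) := mul_le_mul hg hf (l2Norm_nonneg _) hR.le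
  rw [dotProduct_extendedGain_form] at hfH
  have h1 := readout_covariance_tail hM hρ hΛ hW hlaw h0 hx n (g ᵥ* extendedGain L)
    (f ᵥ* extendedGain L) (V := (R / (1 - ρ)) ^ 2 * n) (t := 99 / 100 * (n * τ)) (τ := n * τ)
    ?_ (by positivity) (by positivity) ?_
  · refine le_trans (measure_mono fun ω hω => ?_) (h1.trans (ENNReal.ofReal_le_ofReal ?_))
    · simp only [Set.mem_ofPred_eq] at hω ⊢
      rw [dotProduct_sampleMoment_mulVec, dotProduct_extendedGain_form] at hω
      simp only [Matrix.dotProduct_mulVec _ (extendedGain L)] at hω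
      have h2 : ∀ a b : ℝ, a - n * b = n * (1 / (n : ℝ) * a - b) := fun a b => by field_simp
      rw [h2, abs_mul, abs_of_pos hn0']
      exact mul_le_mul_of_nonneg_left hω hn0'.le
    · gcongr
      refine hexp.trans ?_
      gcongr
      have := l2Norm_nonneg (g ᵥ* extendedGain L)
      have := l2Norm_nonneg (f ᵥ* extendedGain L)
      positivity
  · rw [hfH, mul_one]
    have := l2Norm_nonneg (g ᵥ* extendedGain L)
    gcongr
  · refine le_trans (add_le_add_right ?_ _) hbias
    have h3 : 1 - ρ ≤ 1 - ρ ^ 2 := by nlinarith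
    gcongr

/-- Concentration of the correlation of the noise with the covariates. -/
lemma noise_correlation_tail {n : ℕ} {α K lam : ℝ} (hα : 0 < α) (hK : 0 < K) (hn0 : 0 < n)
    (hn : 4000 * K ≤ n * (1 - ρ))
    (hlam : lam = 6 * gainBound L * √(K / (n * α ^ 2 * (1 - ρ)))) (i : Fin p)
    (j : Fin p ⊕ Fin r) :
    μ {ω | 2 / 5 * (α * lam) ≤
        |((1 / (n : ℝ)) • ∑ t ∈ Finset.range n, W t ω i • (extendedGain L *ᵥ x t ω)) j|} ≤
      ENNReal.ofReal (2 * Real.exp (-(2 * K))) := by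
  have hρ0 : 0 ≤ ρ := (opNormTwo_nonneg M).trans hM
  have hD : 0 < 1 - ρ := by linarith
  have hn0' : (0 : ℝ) < n := by exact_mod_cast hn0
  have hℓ := one_le_gainBound (L := L)
  have hℓ0 : 0 < gainBound L := by linarith
  have hexp := noise_exponent hD hℓ hK hn0' hn
  have hlam' : 2 / 5 * (α * lam) = 12 / 5 * gainBound L * √(K / (n * (1 - ρ))) := by
    rw [hlam, show K / (n * α ^ 2 * (1 - ρ)) = K / (n * (1 - ρ)) / α ^ 2 by field_simp,
      Real.sqrt_div (by positivity), Real.sqrt_sq hα.le]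
    field_simp
    norm_num
  have ha := l2Norm_extendedGain_le (L := L) j
  have h1 := noise_readout_tail hM hρ hΛ hW hlaw h0 hx n i (extendedGain L j)
    (V := n * gainBound L ^ 2 / (2 * (1 - ρ))) (t := n * (2 / 5 * (α * lam))) ?_ (by positivity)
    (by rw [hlam']; positivity)
  · refine le_trans (measure_mono fun ω hω => ?_) (h1.trans (ENNReal.ofReal_le_ofReal ?_))
    · simp only [Set.mem_ofPred_eq] at hω ⊢
      have h2 : ((1 / (n : ℝ)) • ∑ t ∈ Finset.range n, W t ω i • (extendedGain L *ᵥ x t ω)) j =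
          1 / (n : ℝ) * ∑ t ∈ Finset.range n, W t ω i * (extendedGain L j ⬝ᵥ x t ω) := by
        simp [Finset.sum_apply, Matrix.mulVec]
      rw [h2, abs_mul, abs_of_pos (by positivity : (0 : ℝ) < 1 / n)] at hω
      have h3 := mul_le_mul_of_nonneg_left hω hn0'.le
      exact h3.trans (le_of_eq (by field_simp))
    · rw [hlam']
      gcongr
      refine hexp.trans ?_
      gcongr
      have := l2Norm_nonneg (extendedGain L j)
      positivity
  · have h2 := (le_abs_self _).trans
      (abs_lyapunov_le hM hρ hΛ (extendedGain L j) (extendedGain L j))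
    have h3 : 1 - ρ ≤ 1 - ρ ^ 2 := by nlinarith
    have h4 : extendedGain L j ⬝ᵥ Λ *ᵥ extendedGain L j ≤ gainBound L ^ 2 / (1 - ρ) := by
      refine h2.trans ?_
      have := l2Norm_nonneg (extendedGain L j)
      rw [sq (gainBound L)]
      gcongr
    calc (n : ℝ) * (extendedGain L j ⬝ᵥ Λ *ᵥ extendedGain L j) / 2
        ≤ n * (gainBound L ^ 2 / (1 - ρ)) / 2 := by gcongr
      _ = _ := by field_simp

/-- With large probability, every lasso solution for the row `θ₀` is close to `θ₀`. -/
lemma exists_lasso_row_event {n k : ℕ} {α C K J ε lam : ℝ} (hα : 0 < α) (hα1 : α ≤ 1)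
    (hC : 0 < C) (hDC : (1 - ρ) * C ≤ 1) (hk : 1 ≤ k) (hK : 1 ≤ K) (hJ : 0 < J) (hn0 : 0 < n)
    (hε : 0 < ε) (hlam0 : 0 < lam) (hlamC : lam ≤ C * ε / (10 * k))
    (hn : 4000 * (k : ℝ) ^ 3 * gainBound L ^ 2 * K ≤ n * α ^ 2 * (1 - ρ) ^ 3 * C ^ 2)
    (hn' : 4000 * J ≤ n * (1 - ρ))
    (hlam : lam = 6 * gainBound L * √(J / (n * α ^ 2 * (1 - ρ)))) (i : Fin p)
    {θ₀ : Fin p ⊕ Fin r → ℝ} {S : Finset (Fin p ⊕ Fin r)} (hθ₀ : ∀ j ∉ S, θ₀ j = 0)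
    (hSk : S.card ≤ k)
    (hspec : ∀ c ∈ spectrum ℝ (block (extendedGain L * Λ * (extendedGain L)ᵀ) S S), C ≤ c)
    (hinc : opNormInf (block (extendedGain L * Λ * (extendedGain L)ᵀ) Sᶜ S *
      (block (extendedGain L * Λ * (extendedGain L)ᵀ) S S)⁻¹) ≤ 1 - α)
    (hmodel : ∀ t ω, x (t + 1) ω i = θ₀ ⬝ᵥ (extendedGain L *ᵥ x t ω) + W t ω i) :
    ∃ E : Set Ω, μ E ≤ ENNReal.ofReal (((p : ℝ) + r) * (2 * Real.exp (-(2 * J)))) +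
        ENNReal.ofReal (((p : ℝ) + r) * (k * (2 * Real.exp (-(2 * K))))) ∧
      ∀ ω ∉ E, ∀ θ : Fin p ⊕ Fin r → ℝ,
        (∀ θ', loss L n (fun t => x t ω) i θ + lam * l1Norm θ ≤
          loss L n (fun t => x t ω) i θ' + lam * l1Norm θ') → l2Norm (θ - θ₀) ≤ ε := by
  set H := extendedGain L * Λ * (extendedGain L)ᵀ with hHdef
  have hk0 : (0 : ℝ) < k := by exact_mod_cast hk
  have hℓ := one_le_gainBound (L := L)
  have hℓ0 : 0 < gainBound L := by linarith
  have hsC : 0 < √C := Real.sqrt_pos.2 hC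
  have hsk : 0 < √(k : ℝ) := Real.sqrt_pos.2 hk0
  have hH : H.IsHermitian := form_isHermitian hM hρ hΛ
  obtain ⟨f, hfS, hfH, hfspan, hCH⟩ := exists_whitening hH S hC hspec
  have hreg : ∀ j ∉ S, ∃ b : Fin p ⊕ Fin r → ℝ, (∀ i ∉ S, b i = 0) ∧ l1Norm b ≤ 1 - α ∧
      ∀ v, (∀ i ∉ S, v i = 0) → (Pi.single j 1 - b) ⬝ᵥ H *ᵥ v = 0 :=
    fun j hj => exists_regression hH hC hspec hinc hj
  choose! b hbS hb hborth using hreg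
  -- A basis vector has `H`-length one, hence Euclidean length at most `1 / √C`; having at most `k`
  -- nonzero entries costs a further `√k`.
  have hfF : ∀ a, l2Norm (f a ᵥ* extendedGain L) ≤ √k * gainBound L / √C := by
    intro a
    have h1 := hCH (f a) (hfS a)
    rw [hfH, if_pos rfl] at h1
    have h2 : √C * l2Norm (f a) ≤ 1 := by
      refine le_of_sq_le_sq ?_ zero_le_one
      rw [mul_pow, Real.sq_sqrt hC.le, one_pow]
      exact h1
    have h3 := l1Norm_le_sqrt_card (hfS a) hSk
    rw [le_div_iff₀ hsC]
    calc l2Norm (f a ᵥ* extendedGain L) * √C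
        ≤ gainBound L * (√k * l2Norm (f a)) * √C := by
          gcongr
          exact (l2Norm_vecMul_extendedGain_le (f a)).trans (by gcongr)
      _ = √k * gainBound L * (√C * l2Norm (f a)) := by ring
      _ ≤ √k * gainBound L * 1 := by gcongr
      _ = _ := mul_one _
  have hrR : ∀ j ∉ S, l2Norm ((Pi.single j 1 - b j) ᵥ* extendedGain L) ≤ 2 * gainBound L := by
    intro j hj
    rw [Matrix.sub_vecMul, Matrix.single_one_vecMul, sub_eq_add_neg]
    refine (l2Norm_add_le _ _).trans ?_
    have h1 := l2Norm_vecMul_extendedGain_le (L := L) (b j)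
    have h2 : gainBound L * l1Norm (b j) ≤ gainBound L * 1 := by
      have := hb j hj
      gcongr
      linarith
    have h3 := l2Norm_extendedGain_le (L := L) j
    rw [l2Norm_neg]
    change l2Norm (extendedGain L j) + _ ≤ _
    linarith
  set Q : Ω → Matrix (Fin p ⊕ Fin r) (Fin p ⊕ Fin r) ℝ :=
    fun ω => sampleMoment n fun t => extendedGain L *ᵥ x t ω with hQdef
  set N : Fin p ⊕ Fin r → Set Ω := fun j => {ω | 2 / 5 * (α * lam) ≤
    |((1 / (n : ℝ)) • ∑ t ∈ Finset.range n, W t ω i • (extendedGain L *ᵥ x t ω)) j|} with hN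
  -- A single index `j` serves both families, a basis vector for `j ∈ S` and a residual for `j ∉ S`,
  -- so that at most `q * k` events are counted, `q` being the number of covariates.
  set E : Fin p ⊕ Fin r → S → Set Ω := fun j a => if h : j ∈ S then
      {ω | α / (20 * k) ≤ |f ⟨j, h⟩ ⬝ᵥ Q ω *ᵥ f a - f ⟨j, h⟩ ⬝ᵥ H *ᵥ f a|}
    else {ω | α * √C / (10 * k * √k) ≤ |(Pi.single j 1 - b j) ⬝ᵥ Q ω *ᵥ f a -
      (Pi.single j 1 - b j) ⬝ᵥ H *ᵥ f a|} with hE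
  have hEμ : ∀ j a, μ (E j a) ≤ ENNReal.ofReal (2 * Real.exp (-(2 * K))) := by
    intro j a
    by_cases hj : j ∈ S
    · simp only [hE, hj, dif_pos]
      refine sampleMoment_tail hM hρ hΛ hW hlaw h0 hx hα hα1 hC hDC hk hK hn0
        (R := √k * gainBound L / √C) (by positivity) hn ?_ (hfF _) (hfF _) (by rw [hfH, if_pos rfl])
      field_simp
    · simp only [hE, hj, dif_neg, not_false_eq_true]
      refine sampleMoment_tail hM hρ hΛ hW hlaw h0 hx hα hα1 hC hDC hk hK hn0
        (R := 2 * gainBound L) (by positivity) hn ?_ (hrR j hj) (hfF _) (by rw [hfH, if_pos rfl])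
      field_simp
      norm_num
  refine ⟨(⋃ j, N j) ∪ ⋃ j, ⋃ a, E j a, ?_, fun ω hω θ hθ => ?_⟩
  · have hcard : (Fintype.card (Fin p ⊕ Fin r) : ℝ) = p + r := by simp
    refine (measure_union_le _ _).trans (add_le_add ?_ ?_)
    · rw [← hcard]
      exact measure_iUnion_le_card_mul fun j =>
        noise_correlation_tail hM hρ hΛ hW hlaw h0 hx hα hJ hn0 hn' hlam i j
    · rw [← hcard]
      refine measure_iUnion_le_card_mul fun j =>
        (measure_iUnion_le_card_mul (hEμ j)).trans (ENNReal.ofReal_le_ofReal ?_)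
      have : (S.card : ℝ) ≤ k := by exact_mod_cast hSk
      rw [Fintype.card_coe]
      gcongr
  · simp only [Set.mem_union, Set.mem_iUnion, not_or, not_exists] at hω
    obtain ⟨hω1, hω2⟩ := hω
    refine lasso_row_error (sampleMoment_isHermitian _ _) (sampleMoment_nonneg n _) hSk hk hC hα
      hα1 hε hlam0 hlamC hfS hfH hfspan hCH hbS hb hθ₀ (fun j => (not_le.1 (hω1 j)).le)
      (Q := Q ω) (fun a c => ?_) (fun j hj a => ?_) fun θ' => ?_
    · have h1 := hω2 a c
      simp only [hE, a.2, dif_pos, Set.mem_ofPred_eq, not_le, hfH] at h1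
      exact h1.le
    · have h1 := hω2 j a
      simp only [hE, hj, dif_neg, not_false_eq_true, Set.mem_ofPred_eq, not_le,
        hborth j hj _ (hfS a), sub_zero] at h1
      exact h1.le
    · have h1 := hθ θ'
      simp only [loss, hmodel, squared_loss_eq] at h1
      linarith

end System

/-! ### Constraints on the constants, and the union bound -/

/-- The incoherence condition at `S = ∅` bounds a norm, hence a nonnegative number, by `1 - α`. -/
lemma IsIdentifiable.le_one {p r k : ℕ} {ρ Cmin α : ℝ} {A : Matrix (Fin p) (Fin p) ℝ}
    {B : Matrix (Fin p) (Fin r) ℝ} {L : Matrix (Fin r) (Fin p) ℝ}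
    (h : IsIdentifiable k ρ Cmin α A B L) : α ≤ 1 := by
  obtain ⟨-, -, Λ, -, hid⟩ := h
  have h1 := (hid _ rfl ∅ (by simp)).2
  have h2 : 0 ≤ opNormInf (block (extendedGain L * Λ * (extendedGain L)ᵀ) ∅ᶜ ∅ *
      (block (extendedGain L * Λ * (extendedGain L)ᵀ) ∅ ∅)⁻¹) := by
    open scoped Matrix.Norms.Operator in exact norm_nonneg _
  linarith

/-- A lower bound for the spectrum of the covariance of the covariates is bounded by the inverse
of the spectral gap. -/
lemma gap_mul_le_one {p r : ℕ} {L : Matrix (Fin r) (Fin p) ℝ} {M Λ : Matrix (Fin p) (Fin p) ℝ}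
    {ρ C : ℝ} (hM : opNormTwo M ≤ ρ) (hρ : ρ < 1) (hΛ : Λ = 1 + M * Λ * Mᵀ) (hC : 0 < C)
    (i : Fin p) (hspec : ∀ c ∈ spectrum ℝ (block (extendedGain L * Λ * (extendedGain L)ᵀ)
      {Sum.inl i} {Sum.inl i}), C ≤ c) : (1 - ρ) * C ≤ 1 := by
  have hρ0 : 0 ≤ ρ := (opNormTwo_nonneg M).trans hM
  obtain ⟨-, -, -, -, hCH⟩ := exists_whitening (form_isHermitian hM hρ hΛ) {Sum.inl i} hC hspec
  have h1 := hCH (Pi.single (Sum.inl i) 1) fun j hj => by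
    simp only [Finset.mem_singleton] at hj
    simp [hj]
  rw [dotProduct_extendedGain_form, Matrix.single_one_vecMul] at h1
  have h2 := (le_abs_self _).trans
    (abs_lyapunov_le hM hρ hΛ (extendedGain L (Sum.inl i)) (extendedGain L (Sum.inl i)))
  have h3 : l2Norm (Pi.single (Sum.inl i) 1 : Fin p ⊕ Fin r → ℝ) = 1 := by simp [l2Norm]
  rw [l2Norm_extendedGain_inl, one_mul] at h2
  rw [h3, one_pow, mul_one] at h1
  have h4 : 0 < 1 - ρ ^ 2 := by nlinarith
  -- The diagonal entry of `H` at a state coordinate lies between `C` and `1 / (1 - ρ ^ 2)`.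
  have h5 := (le_div_iff₀ h4).1 (h1.trans h2)
  nlinarith

lemma exp_neg_two_mul_log {a b : ℝ} (ha : 0 < a) (hb : 0 < b) :
    Real.exp (-(2 * Real.log (a / b))) = (b / a) ^ 2 := by
  rw [← mul_neg, ← Real.log_inv, inv_div, mul_comm, Real.exp_mul, Real.exp_log (by positivity)]
  norm_cast

/-- The squares come from the factor two in the exponents; the sum equals `(p / q) * (δ ^ 2 / 8) *
(1 + 1 / k)`, at most `δ ^ 2 / 4`. -/
lemma union_bound_lt {p q k δ : ℝ} (hp : 0 ≤ p) (hpq : p ≤ q) (hq : 1 ≤ q) (hk : 1 ≤ k)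
    (hδ : 0 < δ) (hδ1 : δ < 1) :
    p * (q * (2 * (δ / (4 * q)) ^ 2) + q * (k * (2 * (δ / (4 * k * q)) ^ 2))) < δ := by
  have h1 : p * (q * (2 * (δ / (4 * q)) ^ 2) + q * (k * (2 * (δ / (4 * k * q)) ^ 2))) =
      (p / q) * (δ ^ 2 / 8) * (1 + 1 / k) := by
    field_simp
    ring
  have h2 : p / q ≤ 1 := (div_le_one (by linarith)).2 hpq
  have h3 : 1 / k ≤ 1 := (div_le_one (by linarith)).2 hk
  have h4 : 0 ≤ p / q := div_nonneg hp (by linarith)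
  rw [h1]
  calc (p / q) * (δ ^ 2 / 8) * (1 + 1 / k) ≤ 1 * (δ ^ 2 / 8) * (1 + 1) := by gcongr
    _ < δ := by nlinarith

end LQ

/-! ### The main theorem -/

theorem mainTheorem1 {Ω : Type*} [MeasurableSpace Ω] (μ : Measure Ω) [IsProbabilityMeasure μ]
    {p r : ℕ} (k n : ℕ) (hk : 1 ≤ k)
    (A : Matrix (Fin p) (Fin p) ℝ) (B : Matrix (Fin p) (Fin r) ℝ) (L : Matrix (Fin r) (Fin p) ℝ)
    (w x : ℕ → Ω → Fin p → ℝ) (u : ℕ → Ω → Fin r → ℝ)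
    -- the entries of the noise vectors `w(1), w(2), …` are i.i.d. standard normal
    (hw_indep : iIndepFun (fun (s : ℕ × Fin p) (ω : Ω) => w (s.1 + 1) ω s.2) μ)
    (hw_law : ∀ (t : ℕ) (i : Fin p), HasLaw (fun ω => w (t + 1) ω i) (gaussianReal 0 1) μ)
    -- the system, started at rest and driven by the regulator `L`
    (hx_zero : ∀ ω, x 0 ω = 0)
    (hu : ∀ t ω, u t ω = -(L *ᵥ x t ω))
    (hx_succ : ∀ t ω, x (t + 1) ω = A *ᵥ x t ω + B *ᵥ u t ω + w (t + 1) ω)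
    (h_sparse : LQ.IsSparse k (LQ.interaction A B))
    (ρ Cmin α : ℝ) (hC : 0 < Cmin) (hα : 0 < α)
    (hL : LQ.IsIdentifiable k ρ Cmin α A B L)
    (ε δ : ℝ) (hδ : 0 < δ) (hδ_one : δ < 1) (hε : 0 < ε)
    (hε_min : (ε : EReal) < LQ.minEntry (LQ.interaction A B))
    (hε_gain : ε < LQ.gainBound L / 2) (hε_rho : ε < 3 / (1 - ρ))
    (hn : 4 * 10 ^ 3 * (k : ℝ) ^ 2 * LQ.gainBound L ^ 2 / (α ^ 2 * (1 - ρ) * Cmin ^ 2) *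
        (1 / ε ^ 2 + (k : ℝ) / (1 - ρ) ^ 2) * Real.log (4 * (k : ℝ) * ((p : ℝ) + (r : ℝ)) / δ)
        ≤ (n : ℝ))
    (lam : ℝ)
    (h_lam : lam = 6 * LQ.gainBound L *
      √(Real.log (4 * ((p : ℝ) + (r : ℝ)) / δ) / ((n : ℝ) * α ^ 2 * (1 - ρ)))) :
    (∀ ω, ∃ Θ : Matrix (Fin p) (Fin p ⊕ Fin r) ℝ, LQ.IsLasso L n lam (fun t => x t ω) Θ) ∧
    μ {ω | ∃ Θ : Matrix (Fin p) (Fin p ⊕ Fin r) ℝ, LQ.IsLasso L n lam (fun t => x t ω) Θ ∧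
        ε < LQ.rowDist Θ (LQ.interaction A B)} < ENNReal.ofReal δ := by
  -- With no rows the supremum in `rowDist` is the default value `0`, so the bad event is empty; a
  -- state coordinate is needed below for `(1 - ρ) * Cmin ≤ 1`.
  rcases Nat.eq_zero_or_pos p with rfl | hp
  · refine ⟨fun ω => ⟨0, fun i => i.elim0⟩, ?_⟩
    have h : {ω | ∃ Θ : Matrix (Fin 0) (Fin 0 ⊕ Fin r) ℝ,
        LQ.IsLasso L n lam (fun t => x t ω) Θ ∧ ε < LQ.rowDist Θ (LQ.interaction A B)} = ∅ := by
      ext ω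
      simp only [LQ.rowDist, Real.iSup_of_isEmpty, Set.mem_ofPred_eq, Set.mem_empty_iff_false,
        iff_false, not_exists, not_and, not_lt]
      exact fun _ _ => hε.le
    rw [h, measure_empty]
    exact ENNReal.ofReal_pos.2 hδ
  have hα1 := hL.le_one
  obtain ⟨hM, hρ, Λ, hΛ', hid⟩ := hL
  replace hid := hid _ rfl
  have hΛ := hΛ'.eq
  have hD : 0 < 1 - ρ := by linarith
  have hk1 : (1 : ℝ) ≤ k := by exact_mod_cast hk
  have hℓ := LQ.one_le_gainBound (L := L)
  have hDC : (1 - ρ) * Cmin ≤ 1 :=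
    LQ.gap_mul_le_one hM hρ hΛ hC ⟨0, hp⟩ (hid _ (by simpa using hk)).1
  set q : ℝ := (p : ℝ) + r with hq
  have hp1 : (1 : ℝ) ≤ p := by exact_mod_cast hp
  have hpq : (p : ℝ) ≤ q := by
    rw [hq]
    linarith [(Nat.cast_nonneg r : (0 : ℝ) ≤ r)]
  have hq1 : 1 ≤ q := hp1.trans hpq
  set J := Real.log (4 * q / δ) with hJdef
  set K := Real.log (4 * k * q / δ) with hKdef
  -- `4 * q / δ > 4 > exp 1`, since `q ≥ 1` and `δ < 1`.
  have hJ : 1 ≤ J := by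
    rw [hJdef, Real.le_log_iff_exp_le (by positivity), le_div_iff₀ hδ]
    have := Real.exp_one_lt_d9
    have := Real.exp_pos 1
    nlinarith
  have hJK : J ≤ K := by
    refine Real.log_le_log (by positivity) ?_
    gcongr
    linarith
  have hK : 1 ≤ K := hJ.trans hJK
  have hn0 : (0 : ℝ) < n := lt_of_lt_of_le (by positivity) hn
  have hn0' : 0 < n := by exact_mod_cast hn0
  obtain ⟨hn1, hn2⟩ := LQ.sample_size_split hα hD hC hε hk1 (by linarith) hn
  have hn3 : 4000 * J ≤ n * (1 - ρ) := le_trans (by linarith)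
    (LQ.sample_size_mul_gap hα hα1 hD hC hDC hk1 hℓ (by linarith) hn0 hn1)
  have hlam0 : 0 < lam := by
    rw [h_lam]
    have : 0 < J / (n * α ^ 2 * (1 - ρ)) := by positivity
    have := Real.sqrt_pos.2 this
    positivity
  have hlamC := LQ.regularization_le hα hD hC hε hk1 hℓ hn0 (by linarith) hJK hn2 h_lam
  refine ⟨fun ω => LQ.exists_isLasso L n hlam0 _, ?_⟩
  have hx : ∀ t ω, x (t + 1) ω = (A - B * L) *ᵥ x t ω + w (t + 1) ω := by
    intro t ω
    rw [hx_succ, hu, Matrix.mulVec_neg, Matrix.mulVec_mulVec, ← sub_eq_add_neg, Matrix.sub_mulVec]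
  have hrow : ∀ i, ∃ E : Set Ω, μ E ≤
      ENNReal.ofReal (q * (2 * Real.exp (-(2 * J)))) +
        ENNReal.ofReal (q * (k * (2 * Real.exp (-(2 * K))))) ∧
      ∀ ω ∉ E, ∀ θ : Fin p ⊕ Fin r → ℝ,
        (∀ θ', LQ.loss L n (fun t => x t ω) i θ + lam * LQ.l1Norm θ ≤
          LQ.loss L n (fun t => x t ω) i θ' + lam * LQ.l1Norm θ') →
        LQ.l2Norm (θ - LQ.interaction A B i) ≤ ε := by
    intro i
    classical
    set S : Finset (Fin p ⊕ Fin r) := {j | LQ.interaction A B i j ≠ 0} with hS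
    have hSk : S.card ≤ k := by
      have h := h_sparse i
      rwa [Set.ncard_eq_toFinset_card', Set.toFinset_ofPred] at h
    refine LQ.exists_lasso_row_event hM hρ hΛ (W := fun t => w (t + 1)) hw_indep hw_law hx_zero hx
      hα hα1 hC hDC hk hK (by linarith) hn0' hε hlam0 hlamC hn1 hn3 h_lam i (S := S)
      (fun j hj => by simpa [hS] using hj) hSk (hid S hSk).1 (hid S hSk).2 fun t ω => ?_
    rw [hx, ← LQ.interaction_mul_extendedGain, ← Matrix.mulVec_mulVec]
    rfl
  choose E hEμ hE using hrow
  -- The bad event is only covered by the sets `E i`; its measurability is not needed, since `μ` is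
  -- monotone as an outer measure.
  have hsub : {ω | ∃ Θ : Matrix (Fin p) (Fin p ⊕ Fin r) ℝ,
      LQ.IsLasso L n lam (fun t => x t ω) Θ ∧ ε < LQ.rowDist Θ (LQ.interaction A B)} ⊆
      ⋃ i, E i := by
    rintro ω ⟨Θ, hΘ, hdist⟩
    have : Nonempty (Fin p) := ⟨⟨0, hp⟩⟩
    obtain ⟨i, hi⟩ := exists_lt_of_lt_ciSup hdist
    refine Set.mem_iUnion.2 ⟨i, ?_⟩
    by_contra hω
    exact (hE i ω hω (Θ i) (hΘ i)).not_gt hi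
  have hEμ' : ∀ i, μ (E i) ≤ ENNReal.ofReal (q * (2 * Real.exp (-(2 * J))) +
      q * (k * (2 * Real.exp (-(2 * K))))) := fun i => by
    rw [ENNReal.ofReal_add (by positivity) (by positivity)]
    exact hEμ i
  refine (measure_mono hsub).trans_lt ((LQ.measure_iUnion_le_card_mul hEμ').trans_lt ?_)
  rw [ENNReal.ofReal_lt_ofReal_iff hδ, Fintype.card_fin,
    LQ.exp_neg_two_mul_log (by positivity) hδ, LQ.exp_neg_two_mul_log (by positivity) hδ]
  exact LQ.union_bound_lt (by linarith) hpq hq1 hk1 hδ hδ_one
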